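/- **Setting.** Let $B\in\mathbb{C}^{n_1\times\cdots\times n_m}$ and let $1\le k_\ell\le n_\ell$ for $1\le\ell\le m$. Mode multiplication is $(B\times_\ell X)_{i_1\cdots i_m}=\sum_{j}x_{i_\ell j}\,b_{i_1\cdots i_{\ell-1}\,j\,i_{\ell+1}\cdots i_m}$, and $X^{\rm H}$ is the conjugate transpose. For $P_r\in\mathbb{C}^{n_r\times k_r}$ put $$f(P_1,\dots,P_m)=\|B\times_1P_1^{\rm H}\cdots\times_mP_m^{\rm H}\|_F^2 .$$ For each $\ell$ let $C_\ell=C_\ell(P_1,\dots,P_{\ell-1},P_{\ell+1},\dots,P_m)$ be the $\ell$-th unfolding matrix (rows indexed by the $\ell$-th subscript, columns by all the other subscripts) of the tensor obtained from $B$ by multiplying it in every mode $r\ne\ell$ by $P_r^{\rm H}$, and let $H_\ell(P_1,\dots,P_{\ell-1},P_{\ell+1},\dots,P_m)=C_\ell C_\ell^{\rm H}$. Let $\lambda_1(A)\ge\lambda_2(A)\ge\cdots$ be the eigenvalues of a Hermitian matrix $A$ with multiplicity. **Iteration (HOOI).** Let $(P_1^{(j)},\dots,P_m^{(j)})$, $j\ge0$,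 satisfy $[P_\ell^{(0)}]^{\rm H}P_\ell^{(0)}=I$ for all $\ell$ and, for all $j\ge 0$ and $\ell=1,\dots,m$: $P_\ell^{(j+1)}$ has orthonormal columns which span an invariant subspace, associated with the $k_\ell$ largest eigenvalues, of $$H_\ell^{(j)}=H_\ell(P_1^{(j+1)},\dots,P_{\ell-1}^{(j+1)},P_{\ell+1}^{(j)},\dots,P_m^{(j)}).$$ Put $\Lambda_\ell^{(j)}=[P_\ell^{(j)}]^{\rm H}H_\ell^{(j)}P_\ell^{(j)}$ and $\delta_\ell^{(j)}=\lambda_{k_\ell}(H_\ell^{(j)})-\lambda_{k_\ell+1}(H_\ell^{(j)})$. Let $(P_{*1},\dots,P_{*m})$ be an accumulation point of the sequence, the limit of the subsequence with indices $j\in\mathbb I$, and let $(\widehat P_{*1},\dots,\widehat P_{*,m-1})$ be an accumulation point of $\{(P_1^{(j+1)},\dots,P_{m-1}^{(j+1)})\}_{j\in\mathbb I}$. Put $$H_{*\ell}=H_\ell(P_{*1},\dots,P_{*,\ell-1},P_{*,\ell+1},\dots,P_{*m}),\qquad \widehat H_{*\ell}=H_\ell(\widehat P_{*1},\dots,\widehat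 P_{*,\ell-1},P_{*,\ell+1},\dots,P_{*m}).$$ Write $\delta_{*\ell}=\lambda_{k_\ell}(H_{*\ell})-\lambda_{k_\ell+1}(H_{*\ell})$. If $k_\ell=n_\ell$, the condition $\delta_{*\ell}>0$ is regarded as satisfied. **Theorem.** (a) The sequence $f(P_1^{(j)},\dots,P_m^{(j)})$ is monotonically increasing and convergent. (b) For $1\le\ell\le m$, $\widehat H_{*\ell}P_{*\ell}=P_{*\ell}\Lambda_{*\ell}$, where $\Lambda_{*\ell}=P_{*\ell}^{\rm H}\widehat H_{*\ell}P_{*\ell}$ is Hermitian and its eigenvalues are the $k_\ell$ largest eigenvalues of $\widehat H_{*\ell}$. (c) If $\delta_{*\ell}>0$ for $1\le\ell\le m-1$, then $\widehat P_{*\ell}=P_{*\ell}Q_{*\ell}$ with a unitary $Q_{*\ell}\in\mathbb{C}^{k_\ell\times k_\ell}$ for $1\le\ell\le m-1$, and, for $1\le\ell\le m$, $\widehat H_{*\ell}=H_{*\ell}$ and $H_{*\ell}P_{*\ell}=P_{*\ell}\Lambda_{*\ell}$, where $\Lambda_{*\ell}=P_{*\ell}^{\rm H}H_{*\ell}P_{*\ell}$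 is Hermitian and its eigenvalues are the $k_\ell$ largest eigenvalues of $H_{*\ell}$. (d) Let $Q_\ell^{(j)}\in\mathbb{C}^{k_\ell\times k_\ell}$ be a unitary polar factor of $[P_\ell^{(j)}]^{\rm H}P_{*\ell}$ (that is, $[P_\ell^{(j)}]^{\rm H}P_{*\ell}=Q_\ell^{(j)}\Gamma$ with $\Gamma\succeq0$). If $(P_{*1},\dots,P_{*m})$ is an isolated accumulation point of $\{(P_1^{(j)}Q_1^{(j)},\dots,P_m^{(j)}Q_m^{(j)})\}_{j\ge0}$ and $\delta_{*\ell}>0$ for all $1\le\ell\le m$, then this whole sequence converges to $(P_{*1},\dots,P_{*m})$. (e) For $1\le\ell\le m$, $$\sum_{j=0}^\infty\delta_\ell^{(j)}\,\big\|\sin\Theta\big(\mathcal R(P_\ell^{(j+1)}),\mathcal R(P_\ell^{(j)})\big)\big\|_F^2<\infty,\qquad \sum_{j=0}^\infty\delta_\ell^{(j)}\,\frac{\|H_\ell^{(j)}P_\ell^{(j)}-P_\ell^{(j)}\Lambda_\ell^{(j)}\|_F^2}{\|H_\ell^{(j)}\|_F^2}<\infty,$$ where, for $X,Y$ with $k$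 orthonormal columns, $\Theta(\mathcal R(X),\mathcal R(Y))$ is the diagonal matrix of the canonical angles $\arccos\sigma_i(X^{\rm H}Y)$, $1\le i\le k$. Terms with $H_\ell^{(j)}=0$ or with $k_\ell=n_\ell$ are read as $0$. -/

import Mathlib

open scoped Matrix Topology ComplexOrder
open Filter

noncomputable section

namespace HOOI

/-- A complex tensor whose modes are indexed by `ι` and whose mode `ℓ` has dimension `n ℓ`. -/
abbrev Tensor {ι : Type} (n : ι → ℕ) : Type := (∀ ℓ, Fin (n ℓ)) → ℂ

/-- The Frobenius norm of a tensor. -/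
def tensorFrob {ι : Type} [Fintype ι] [DecidableEq ι] {n : ι → ℕ} (T : Tensor n) : ℝ :=
  Real.sqrt (∑ i, ‖T i‖ ^ 2)

/-- The result of multiplying the tensor `B` in every mode `ℓ` by the matrix `X ℓ`. The mode
multiplications in different modes commute, and carrying all of them out one after the other gives
`∑ j, (∏ ℓ, X ℓ (i ℓ) (j ℓ)) * B j` as the entry at the multi-index `i`. -/
def multiModeMul {ι : Type} [Fintype ι] [DecidableEq ι] {n p : ι → ℕ} (B : Tensor n)
    (X : ∀ ℓ, Matrix (Fin (p ℓ)) (Fin (n ℓ)) ℂ) : Tensor p :=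
  fun i => ∑ j : (∀ ℓ, Fin (n ℓ)), (∏ ℓ, X ℓ (i ℓ) (j ℓ)) * B j

/-- The `ℓ`-th unfolding matrix of `B`: its rows are indexed by the `ℓ`-th subscript and its
columns by the tuple of all the other subscripts. -/
def unfold {ι : Type} [DecidableEq ι] {n : ι → ℕ} (B : Tensor n) (ℓ : ι) :
    Matrix (Fin (n ℓ)) (∀ r : {r // r ≠ ℓ}, Fin (n r)) ℂ :=
  fun a c => B ((Equiv.piSplitAt ℓ fun r => Fin (n r)).symm (a, c))

/-- The Frobenius norm of a matrix (Mathlib's). -/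
def frob {α β : Type} [Fintype α] [Fintype β] (A : Matrix α β ℂ) : ℝ :=
  (Matrix.frobeniusNormedAddCommGroup (m := α) (n := β) (α := ℂ)).toNorm.norm A

/-- Membership in the complex Stiefel manifold: `Pᴴ P = I`. -/
def IsStiefel {n k : ℕ} (P : Matrix (Fin n) (Fin k) ℂ) : Prop := Pᴴ * P = 1

/-- `eig A i` is the `i`-th eigenvalue `λ_i(A)` of the Hermitian matrix `A`, counted with
multiplicity, in decreasing order and for `1 ≤ i ≤ n`. (It is `0` for other `i` and for
non-Hermitian `A`.) -/
def eig {n : ℕ} (A : Matrix (Fin n) (Fin n) ℂ) (i : ℕ) : ℝ :=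
  open Classical in
  if h : A.IsHermitian ∧ 1 ≤ i ∧ i ≤ n then
    h.1.eigenvalues₀ ⟨i - 1, by rw [Fintype.card_fin]; omega⟩
  else 0

/-- The eigengap `λ_k(A) - λ_{k+1}(A)`, for `1 ≤ k < n`. -/
def eigGap {n : ℕ} (A : Matrix (Fin n) (Fin n) ℂ) (k : ℕ) : ℝ := eig A k - eig A (k + 1)

/-- The gap between the `k` largest eigenvalues of `A` and the remaining ones is positive; there is
nothing to require when `k = n`, because then no eigenvalue remains. -/
def HasPosGap {n : ℕ} (A : Matrix (Fin n) (Fin n) ℂ) (k : ℕ) : Prop := k < n → 0 < eigGap A k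

/-- The partial eigen-decomposition `H P = P Λ` with `Λ = Pᴴ H P` Hermitian, where the eigenvalues
of `Λ` are the `k` largest eigenvalues of `H`, with multiplicities. -/
def IsTopEigenpair {n k : ℕ} (H : Matrix (Fin n) (Fin n) ℂ) (P : Matrix (Fin n) (Fin k) ℂ) : Prop :=
  H * P = P * (Pᴴ * H * P) ∧ (Pᴴ * H * P).IsHermitian ∧
    ∀ i, 1 ≤ i → i ≤ k → eig (Pᴴ * H * P) i = eig H i

/-- `P` is a top-`k` eigenvector matrix of `H`: its columns form an orthonormal basis of an
invariant subspace of `H` that carries the `k` largest eigenvalues. Any orthonormal basis of such a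
subspace is allowed, in particular one made of eigenvectors. -/
def IsTopEigenbasis {n k : ℕ} (H : Matrix (Fin n) (Fin n) ℂ) (P : Matrix (Fin n) (Fin k) ℂ) :
    Prop :=
  IsStiefel P ∧ IsTopEigenpair H P

/-- `Q` is an orthonormal polar factor of the square matrix `A`: `A = Q Γ` with `Q` unitary and `Γ`
positive semidefinite. -/
def IsPolarFactor {k : ℕ} (A Q : Matrix (Fin k) (Fin k) ℂ) : Prop :=
  IsStiefel Q ∧ ∃ Γ : Matrix (Fin k) (Fin k) ℂ, Γ.PosSemidef ∧ A = Q * Γ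

/-- The canonical angles `arccos σ_i(Xᴴ Y)` between the column spaces of `X` and `Y`, two matrices
with `k` orthonormal columns. -/
def canonicalAngle {n k : ℕ} (X Y : Matrix (Fin n) (Fin k) ℂ) (i : Fin k) : ℝ :=
  Real.arccos ((Matrix.toEuclideanLin (Xᴴ * Y)).singularValues i)

/-- `‖sin Θ(R(X), R(Y))‖_F`. -/
def sinThetaFrob {n k : ℕ} (X Y : Matrix (Fin n) (Fin k) ℂ) : ℝ :=
  Real.sqrt (∑ i : Fin k, Real.sin (canonicalAngle X Y i) ^ 2)

/-- `y` is an isolated accumulation point of the sequence `s`: an accumulation point with a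
neighbourhood that contains no other accumulation point of `s`. -/
def IsIsolatedAccPt {X : Type} [TopologicalSpace X] (s : ℕ → X) (y : X) : Prop :=
  MapClusterPt y atTop s ∧ ∃ U ∈ 𝓝 y, ∀ z ∈ U, MapClusterPt z atTop s → z = y

variable {m : ℕ} {n k : Fin m → ℕ}

/-- A tuple `(P_1, …, P_m)` with `P_ℓ` of size `n_ℓ × k_ℓ`. -/
abbrev Factors (n k : Fin m → ℕ) : Type := ∀ ℓ, Matrix (Fin (n ℓ)) (Fin (k ℓ)) ℂ

/-- The objective `f(P_1, …, P_m) = ‖B ×₁ P_1ᴴ ⋯ ×ₘ P_mᴴ‖_F²`. -/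
def objective (B : Tensor n) (P : Factors n k) : ℝ :=
  tensorFrob (multiModeMul B fun ℓ => (P ℓ)ᴴ) ^ 2

/-- `C_ℓ`, the `ℓ`-th unfolding of the product of `B` with `P_rᴴ` in every mode `r ≠ ℓ`. As mode
`ℓ` is left alone, the multiplication acts on each row of the `ℓ`-th unfolding of `B`, seen as a
tensor in the other modes. The component `P ℓ` does not enter. -/
def matC (B : Tensor n) (P : Factors n k) (ℓ : Fin m) :
    Matrix (Fin (n ℓ)) (∀ r : {r // r ≠ ℓ}, Fin (k r)) ℂ :=
  fun a => multiModeMul (n := fun r : {r // r ≠ ℓ} => n r) (p := fun r : {r // r ≠ ℓ} => k r)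
    (unfold B ℓ a) fun r => (P r)ᴴ

/-- `H_ℓ = C_ℓ C_ℓᴴ`. -/
def matH (B : Tensor n) (P : Factors n k) (ℓ : Fin m) : Matrix (Fin (n ℓ)) (Fin (n ℓ)) ℂ :=
  matC B P ℓ * (matC B P ℓ)ᴴ

/-- The tuple `(P'_1, …, P'_{ℓ-1}, P_ℓ, …, P_m)`. -/
def mix (P' P : Factors n k) (ℓ : Fin m) : Factors n k := fun r => if r < ℓ then P' r else P r

/-- The matrix `H_ℓ(P'_1, …, P'_{ℓ-1}, P_{ℓ+1}, …, P_m)`. -/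
def mixH (B : Tensor n) (P' P : Factors n k) (ℓ : Fin m) : Matrix (Fin (n ℓ)) (Fin (n ℓ)) ℂ :=
  matH B (mix P' P ℓ) ℓ

/-- `P 0, P 1, …` is generated by the higher-order orthogonal iteration for `B`: the initial
factors have orthonormal columns, and `P_ℓ^{(j+1)}` is a top-`k_ℓ` eigenvector matrix of
`H_ℓ^{(j)} = H_ℓ(P_1^{(j+1)}, …, P_{ℓ-1}^{(j+1)}, P_{ℓ+1}^{(j)}, …, P_m^{(j)})`. -/
structure IsHOOI (B : Tensor n) (P : ℕ → Factors n k) : Prop where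
  init : ∀ ℓ, IsStiefel (P 0 ℓ)
  step : ∀ j ℓ, IsTopEigenbasis (mixH B (P (j + 1)) (P j) ℓ) (P (j + 1) ℓ)

/-- The components of index `1, …, m - 1` of a tuple. -/
def initial (P : Factors n k) (ℓ : {ℓ : Fin m // ℓ.val + 1 < m}) :
    Matrix (Fin (n ℓ)) (Fin (k ℓ)) ℂ :=
  P ℓ

end HOOI

end

/-! With all factors but the `ℓ`-th frozen, the objective is `tr(Pᴴ H_ℓ P)` (`objective_eq_trace`),
and by Ky Fan's principle its maximizers over orthonormal `P` are exactly the top eigenbases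
(`isTopEigenpair_iff`). HOOI is therefore block coordinate ascent on a compact set, so the objective
increases and converges.

Being a maximizer is a closed condition, so limits of sweeps are sweeps (`IsSweep.of_tendsto`). Both
ends of a limit sweep have the same objective value, so none of its substeps gains anything and the
old factors are already maximizers (`IsSweep.isTopEigenpair`): this is (b). Under a positive gap the
maximizing subspace is unique. Since `H_ℓ` sees the other factors only through their projections,
induction on `ℓ` shows that the limit sweep merely rotates bases (`IsSweep.eq_mul`): this is (c).

For (d), polar factors remove that rotation: along ultrafilters on which the aligned iterates tend
to the accumulation point, their successors do too, and an isolated accumulation point with this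
property attracts the whole sequence. For (e), the Ky Fan defect is at least the gap times the
squared sine distance (`IsTopEigenbasis.gap_mul_le`), the residual is bounded by that distance
(`sqNorm_residual_le`), and the gains in the objective telescope. -/

namespace HOOI

/-! ### Squared Frobenius norms -/

section Frobenius

variable {α β γ : Type} [Fintype α] [Fintype β] [Fintype γ]

/-- The squared Frobenius norm of a matrix. -/
noncomputable def sqNorm (A : Matrix α β ℂ) : ℝ := ∑ i, ∑ j, ‖A i j‖ ^ 2

lemma sqNorm_nonneg (A : Matrix α β ℂ) : 0 ≤ sqNorm A := by
  unfold sqNorm; positivity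

lemma trace_conjTranspose_mul_self (A : Matrix α β ℂ) : (Aᴴ * A).trace = (sqNorm A : ℂ) := by
  simp only [sqNorm, Matrix.trace, Matrix.diag, Matrix.mul_apply, Matrix.conjTranspose_apply]
  rw [Finset.sum_comm]
  push_cast
  refine Finset.sum_congr rfl fun i _ => Finset.sum_congr rfl fun j _ => ?_
  rw [Complex.star_def, mul_comm, Complex.mul_conj, Complex.normSq_eq_norm_sq]
  push_cast
  rfl

lemma sqNorm_conjTranspose (A : Matrix α β ℂ) : sqNorm Aᴴ = sqNorm A := by
  unfold sqNorm
  rw [Finset.sum_comm]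
  simp

lemma frob_sq (A : Matrix α β ℂ) : frob A ^ 2 = sqNorm A := by
  have h : frob A = (∑ i, ∑ j, ‖A i j‖ ^ (2 : ℝ)) ^ (1 / 2 : ℝ) := Matrix.frobenius_norm_def A
  rw [h, ← Real.sqrt_eq_rpow, Real.sq_sqrt (by positivity)]
  simp [sqNorm]

lemma sqNorm_eq_zero_iff {A : Matrix α β ℂ} : sqNorm A = 0 ↔ A = 0 := by
  rw [← Matrix.trace_conjTranspose_mul_self_eq_zero_iff, trace_conjTranspose_mul_self]
  norm_cast

lemma sqNorm_mul_le (A : Matrix α β ℂ) (B : Matrix β γ ℂ) :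
    sqNorm (A * B) ≤ sqNorm A * sqNorm B := by
  rw [← frob_sq, ← frob_sq, ← frob_sq, ← mul_pow]
  have h : frob (A * B) ≤ frob A * frob B := Matrix.frobenius_norm_mul A B
  have h0 : 0 ≤ frob (A * B) :=
    letI := Matrix.frobeniusNormedAddCommGroup (m := α) (n := γ) (α := ℂ)
    norm_nonneg (A * B)
  exact pow_le_pow_left₀ h0 h 2

lemma sqNorm_add_le (A B : Matrix α β ℂ) :
    sqNorm (A + B) ≤ 2 * (sqNorm A + sqNorm B) := by
  unfold sqNorm
  simp only [← Finset.sum_add_distrib, Finset.mul_sum]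
  refine Finset.sum_le_sum fun i _ => Finset.sum_le_sum fun j _ => ?_
  have := norm_add_le (A i j) (B i j)
  have h0 := norm_nonneg (A i j + B i j)
  rw [Matrix.add_apply]
  nlinarith [sq_nonneg (‖A i j‖ - ‖B i j‖)]

end Frobenius

/-! ### Matrices with orthonormal columns and their projections -/

section Stiefel

variable {n k : ℕ}

lemma IsStiefel.mul_conjTranspose {Q : Matrix (Fin k) (Fin k) ℂ} (hQ : IsStiefel Q) :
    Q * Qᴴ = 1 := mul_eq_one_comm.mp hQ

lemma IsStiefel.mul {l : ℕ} {P : Matrix (Fin n) (Fin k) ℂ} {Q : Matrix (Fin k) (Fin l) ℂ}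
    (hP : IsStiefel P) (hQ : IsStiefel Q) : IsStiefel (P * Q) := by
  unfold IsStiefel at *
  rw [Matrix.conjTranspose_mul, Matrix.mul_assoc, ← Matrix.mul_assoc _ P, hP, Matrix.one_mul, hQ]

lemma IsStiefel.sqNorm_eq {P : Matrix (Fin n) (Fin k) ℂ} (hP : IsStiefel P) : sqNorm P = k := by
  have h := trace_conjTranspose_mul_self P
  rw [hP, Matrix.trace_one, Fintype.card_fin] at h
  exact_mod_cast h.symm

/-- The Pythagorean identity for the orthogonal projection onto the column space of `X`. -/
lemma IsStiefel.sqNorm_sub {α : Type} [Fintype α] {X : Matrix (Fin n) (Fin k) ℂ}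
    (hX : IsStiefel X) (A : Matrix (Fin n) α ℂ) :
    sqNorm (A - X * (Xᴴ * A)) = sqNorm A - sqNorm (Xᴴ * A) := by
  have h : (A - X * (Xᴴ * A))ᴴ * (A - X * (Xᴴ * A)) = Aᴴ * A - (Xᴴ * A)ᴴ * (Xᴴ * A) := by
    have h1 : Xᴴ * (X * (Xᴴ * A)) = Xᴴ * A := by rw [← Matrix.mul_assoc, hX, Matrix.one_mul]
    simp only [Matrix.conjTranspose_sub, Matrix.conjTranspose_mul,
      Matrix.conjTranspose_conjTranspose, Matrix.sub_mul, Matrix.mul_sub, Matrix.mul_assoc, h1]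
    abel
  have h2 := congrArg Matrix.trace h
  rw [Matrix.trace_sub] at h2
  simp only [trace_conjTranspose_mul_self] at h2
  exact_mod_cast h2

lemma IsStiefel.sqNorm_conjTranspose_mul_le {α : Type} [Fintype α] {X : Matrix (Fin n) (Fin k) ℂ}
    (hX : IsStiefel X) (A : Matrix (Fin n) α ℂ) : sqNorm (Xᴴ * A) ≤ sqNorm A := by
  have := hX.sqNorm_sub A
  linarith [sqNorm_nonneg (A - X * (Xᴴ * A))]

lemma IsStiefel.sqNorm_proj_le {α : Type} [Fintype α] {X : Matrix (Fin n) (Fin k) ℂ}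
    (hX : IsStiefel X) (A : Matrix (Fin n) α ℂ) : sqNorm (A - X * (Xᴴ * A)) ≤ sqNorm A := by
  rw [hX.sqNorm_sub A]
  linarith [sqNorm_nonneg (Xᴴ * A)]

/-- Two matrices with orthonormal columns and maximal overlap differ by a unitary factor. -/
lemma IsStiefel.eq_mul_of_sqNorm {X Y : Matrix (Fin n) (Fin k) ℂ} (hX : IsStiefel X)
    (hY : IsStiefel Y) (h : (k : ℝ) ≤ sqNorm (Xᴴ * Y)) :
    IsStiefel (Xᴴ * Y) ∧ Y = X * (Xᴴ * Y) := by
  have h1 := hX.sqNorm_sub Y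
  rw [hY.sqNorm_eq] at h1
  have h2 : sqNorm (Y - X * (Xᴴ * Y)) = 0 :=
    le_antisymm (by linarith) (sqNorm_nonneg _)
  have h3 : Y = X * (Xᴴ * Y) := sub_eq_zero.mp (sqNorm_eq_zero_iff.mp h2)
  refine ⟨?_, h3⟩
  unfold IsStiefel
  rw [Matrix.conjTranspose_mul, Matrix.conjTranspose_conjTranspose, Matrix.mul_assoc, ← h3, hY]

lemma IsStiefel.eq_mul_of_square {X Y : Matrix (Fin n) (Fin n) ℂ} (hX : IsStiefel X)
    (hY : IsStiefel Y) : IsStiefel (Xᴴ * Y) ∧ Y = X * (Xᴴ * Y) := by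
  refine ⟨?_, by rw [← Matrix.mul_assoc, hX.mul_conjTranspose, Matrix.one_mul]⟩
  have : IsStiefel Xᴴ := by
    unfold IsStiefel; rw [Matrix.conjTranspose_conjTranspose, hX.mul_conjTranspose]
  exact this.mul hY

lemma IsStiefel.mul_mul_conjTranspose {X : Matrix (Fin n) (Fin k) ℂ}
    {Q : Matrix (Fin k) (Fin k) ℂ} (hQ : IsStiefel Q) : (X * Q) * (X * Q)ᴴ = X * Xᴴ := by
  rw [Matrix.conjTranspose_mul, Matrix.mul_assoc, ← Matrix.mul_assoc Q, hQ.mul_conjTranspose,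
    Matrix.one_mul]

/-- The overlap of `X` and `P` depends only on the projection `X Xᴴ`. -/
lemma sqNorm_conjTranspose_mul_congr {l : ℕ} {X Y : Matrix (Fin n) (Fin k) ℂ}
    (h : X * Xᴴ = Y * Yᴴ) (P : Matrix (Fin n) (Fin l) ℂ) :
    sqNorm (Xᴴ * P) = sqNorm (Yᴴ * P) := by
  have h1 : (Xᴴ * P)ᴴ * (Xᴴ * P) = (Yᴴ * P)ᴴ * (Yᴴ * P) := by
    simp only [Matrix.conjTranspose_mul, Matrix.conjTranspose_conjTranspose, Matrix.mul_assoc]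
    simp only [← Matrix.mul_assoc X, ← Matrix.mul_assoc Y, h]
  have h2 := congrArg Matrix.trace h1
  simp only [trace_conjTranspose_mul_self] at h2
  exact_mod_cast h2

end Stiefel

/-! ### Ordered eigenvalues and diagonalization -/

section Eig

variable {n : ℕ} {H : Matrix (Fin n) (Fin n) ℂ}

lemma eig_succ (hH : H.IsHermitian) (i : Fin n) :
    eig H (i + 1) = hH.eigenvalues₀ ⟨i, by simp⟩ := by
  have h : H.IsHermitian ∧ 1 ≤ (i : ℕ) + 1 ∧ (i : ℕ) + 1 ≤ n := ⟨hH, by omega, by omega⟩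
  simp [eig, h]

lemma eig_antitone (hH : H.IsHermitian) : Antitone fun i : Fin n => eig H (i + 1) := by
  intro i j hij
  simp only [eig_succ hH]
  exact hH.eigenvalues₀_antitone hij

/-- The eigenvector matrix is reindexed by `σ`, which undoes the arbitrary indexing of `eigenvalues`
and lists the columns by decreasing eigenvalue. -/
lemma exists_spectral (hH : H.IsHermitian) : ∃ U : Matrix (Fin n) (Fin n) ℂ,
    IsStiefel U ∧ H = U * Matrix.diagonal (fun i : Fin n => (eig H (i + 1) : ℂ)) * Uᴴ := by
  let σ : Fin n ≃ Fin n :=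
    (finCongr (Fintype.card_fin n).symm).trans (Fintype.equivOfCardEq (Fintype.card_fin _))
  have hσ : ∀ i, hH.eigenvalues (σ i) = eig H (i + 1) := by
    intro i
    rw [eig_succ hH, Matrix.IsHermitian.eigenvalues]
    simp [σ]
    rfl
  let V : Matrix (Fin n) (Fin n) ℂ := hH.eigenvectorUnitary
  have hV : Vᴴ * V = 1 := Matrix.UnitaryGroup.star_mul_self hH.eigenvectorUnitary
  have hs : H = V * Matrix.diagonal (fun i => (hH.eigenvalues i : ℂ)) * Vᴴ := by
    have := hH.spectral_theorem
    rw [Unitary.conjStarAlgAut_apply] at this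
    exact this
  refine ⟨V.submatrix id σ, ?_, ?_⟩
  · unfold IsStiefel
    rw [Matrix.conjTranspose_submatrix, ← Matrix.submatrix_mul _ _ _ id _ Function.bijective_id, hV,
      Matrix.submatrix_one_equiv]
  · have hd : Matrix.diagonal (fun i : Fin n => (eig H (i + 1) : ℂ)) =
        (Matrix.diagonal (fun i => (hH.eigenvalues i : ℂ))).submatrix σ σ := by
      rw [Matrix.submatrix_diagonal_equiv]
      congr 1
      funext i
      simp [hσ]
    rw [hd, Matrix.conjTranspose_submatrix, Matrix.submatrix_mul_equiv, Matrix.submatrix_mul_equiv,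
      ← hs]
    rfl

lemma trace_eq_sum_eig (hH : H.IsHermitian) : H.trace.re = ∑ i ∈ Finset.range n, eig H (i + 1) := by
  obtain ⟨U, hU, h⟩ := exists_spectral hH
  rw [Finset.sum_range]
  conv_lhs => rw [h]
  rw [Matrix.trace_mul_comm, ← Matrix.mul_assoc, hU, Matrix.one_mul, Matrix.trace_diagonal]
  simp

end Eig

/-! ### Ky Fan's principle, its equality case and its gap estimate -/

section KyFan

variable {n k : ℕ}

/-- The squared Euclidean norm of the `i`-th row of a matrix. -/
noncomputable def rowWeight (X : Matrix (Fin n) (Fin k) ℂ) (i : Fin n) : ℝ := ∑ j, ‖X i j‖ ^ 2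

lemma rowWeight_nonneg (X : Matrix (Fin n) (Fin k) ℂ) (i : Fin n) : 0 ≤ rowWeight X i := by
  unfold rowWeight; positivity

lemma mul_conjTranspose_diag (X : Matrix (Fin n) (Fin k) ℂ) (i : Fin n) :
    (X * Xᴴ) i i = (rowWeight X i : ℂ) := by
  simp only [Matrix.mul_apply, Matrix.conjTranspose_apply, rowWeight]
  push_cast
  refine Finset.sum_congr rfl fun j _ => ?_
  rw [Complex.star_def, Complex.mul_conj, Complex.normSq_eq_norm_sq]
  push_cast
  rfl

lemma trace_conjTranspose_diagonal (d : Fin n → ℝ) (X : Matrix (Fin n) (Fin k) ℂ) :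
    (Xᴴ * Matrix.diagonal (fun i => (d i : ℂ)) * X).trace.re = ∑ i, d i * rowWeight X i := by
  rw [Matrix.trace_mul_comm, ← Matrix.mul_assoc, Matrix.trace_mul_comm]
  simp only [Matrix.trace, Matrix.diag, Matrix.diagonal_mul, mul_conjTranspose_diag]
  simp

lemma IsStiefel.sum_rowWeight {X : Matrix (Fin n) (Fin k) ℂ} (hX : IsStiefel X) :
    ∑ i, rowWeight X i = k := hX.sqNorm_eq

lemma IsStiefel.sum_norm_proj {X : Matrix (Fin n) (Fin k) ℂ} (hX : IsStiefel X) (i : Fin n) :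
    ∑ j, ‖(X * Xᴴ) i j‖ ^ 2 = rowWeight X i := by
  have h : (X * Xᴴ) * (X * Xᴴ)ᴴ = X * Xᴴ := by
    rw [Matrix.conjTranspose_mul, Matrix.conjTranspose_conjTranspose, Matrix.mul_assoc,
      ← Matrix.mul_assoc Xᴴ, hX, Matrix.one_mul]
  have h1 := mul_conjTranspose_diag (X * Xᴴ) i
  rw [h, mul_conjTranspose_diag] at h1
  exact_mod_cast h1.symm

/-- A diagonal entry `w` of a projection satisfies `w² ≤ w`, since `w` is also the squared norm of
its row. -/
lemma IsStiefel.rowWeight_le_one {X : Matrix (Fin n) (Fin k) ℂ} (hX : IsStiefel X) (i : Fin n) :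
    rowWeight X i ≤ 1 := by
  have h1 := hX.sum_norm_proj i
  have h2 : ‖(X * Xᴴ) i i‖ ^ 2 ≤ ∑ j, ‖(X * Xᴴ) i j‖ ^ 2 :=
    Finset.single_le_sum (f := fun j => ‖(X * Xᴴ) i j‖ ^ 2) (fun j _ => by positivity)
      (Finset.mem_univ i)
  rw [h1, mul_conjTranspose_diag, Complex.norm_real, Real.norm_eq_abs, sq_abs] at h2
  nlinarith [rowWeight_nonneg X i]

/-- If the `i`-th basis vector lies in the column space of `X` or is orthogonal to it, then the
`i`-th row of the projection `X Xᴴ` is diagonal. -/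
lemma IsStiefel.proj_apply_eq_zero {X : Matrix (Fin n) (Fin k) ℂ} (hX : IsStiefel X) {i j : Fin n}
    (hij : i ≠ j) (h : rowWeight X i = 0 ∨ rowWeight X i = 1) : (X * Xᴴ) i j = 0 := by
  have h1 := hX.sum_norm_proj i
  have h2 : ‖(X * Xᴴ) i i‖ ^ 2 + ‖(X * Xᴴ) i j‖ ^ 2 ≤ ∑ j, ‖(X * Xᴴ) i j‖ ^ 2 := by
    rw [← Finset.sum_pair (f := fun j => ‖(X * Xᴴ) i j‖ ^ 2) hij]
    exact Finset.sum_le_sum_of_subset_of_nonneg (Finset.subset_univ _)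
      fun j _ _ => by positivity
  rw [h1, mul_conjTranspose_diag, Complex.norm_real, Real.norm_eq_abs, sq_abs] at h2
  have h3 : ‖(X * Xᴴ) i j‖ ^ 2 ≤ 0 := by rcases h with h | h <;> rw [h] at h2 <;> linarith
  exact norm_eq_zero.mp (pow_eq_zero_iff two_ne_zero |>.mp (le_antisymm h3 (by positivity)))

lemma sum_range_eq_sum_ite (hkn : k ≤ n) (e : ℕ → ℝ) :
    ∑ i ∈ Finset.range k, e i = ∑ i : Fin n, if (i : ℕ) < k then e i else 0 := by
  rw [Fin.sum_univ_eq_sum_range (fun i => if i < k then e i else 0) n, ← Finset.sum_filter]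
  refine Finset.sum_congr ?_ fun _ _ => rfl
  ext i
  simp only [Finset.mem_range, Finset.mem_filter]
  omega

/-- The weights have total `k`, so shifting every `e i` by a pivot `t` changes nothing. For
decreasing `e`, weights in `[0, 1]` and `t` the `k`-th value, every summand on the right is
nonnegative; this drives the Ky Fan bound, its equality case and its gap version. -/
lemma sum_range_sub_weighted (hkn : k ≤ n) (e : ℕ → ℝ) (w : Fin n → ℝ) (hw : ∑ i, w i = k)
    (t : ℝ) :
    ∑ i ∈ Finset.range k, e i - ∑ i : Fin n, e i * w i =
      ∑ i : Fin n, if (i : ℕ) < k then (e i - t) * (1 - w i) else (t - e i) * w i := by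
  have h1 : (k : ℝ) * t = ∑ i : Fin n, if (i : ℕ) < k then t else 0 := by
    rw [← sum_range_eq_sum_ite hkn fun _ => t]; simp
  have h2 : ∑ i, t * w i = k * t := by rw [← Finset.mul_sum, hw, mul_comm]
  have h3 : ∑ i ∈ Finset.range k, e i - ∑ i : Fin n, e i * w i =
      ∑ i ∈ Finset.range k, e i - ∑ i : Fin n, e i * w i + ∑ i, t * w i - k * t := by rw [h2]; ring
  rw [h3, h1, sum_range_eq_sum_ite hkn, ← Finset.sum_sub_distrib, ← Finset.sum_add_distrib,
    ← Finset.sum_sub_distrib]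
  refine Finset.sum_congr rfl fun i _ => ?_
  split_ifs <;> ring

variable {H : Matrix (Fin n) (Fin n) ℂ}

/-- The value of the quadratic form at `P` in the coordinates of an eigenbasis of `H`. -/
lemma exists_eigenbasis_coordinates (hH : H.IsHermitian) :
    ∃ U : Matrix (Fin n) (Fin n) ℂ, IsStiefel U ∧ IsStiefel Uᴴ ∧
      H = U * Matrix.diagonal (fun i : Fin n => (eig H (i + 1) : ℂ)) * Uᴴ ∧
      ∀ {l : ℕ} (P : Matrix (Fin n) (Fin l) ℂ), Pᴴ * H * P =
        (Uᴴ * P)ᴴ * Matrix.diagonal (fun i : Fin n => (eig H (i + 1) : ℂ)) * (Uᴴ * P) := by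
  obtain ⟨U, hU, h⟩ := exists_spectral hH
  refine ⟨U, hU, ?_, h, fun P => ?_⟩
  · unfold IsStiefel
    rw [Matrix.conjTranspose_conjTranspose, hU.mul_conjTranspose]
  · conv_lhs => rw [h]
    simp only [Matrix.conjTranspose_mul, Matrix.conjTranspose_conjTranspose, Matrix.mul_assoc]

/-- **Ky Fan's maximum principle**, the bound. -/
theorem kyFan_le (hH : H.IsHermitian) (hk : 1 ≤ k) (hkn : k ≤ n) {P : Matrix (Fin n) (Fin k) ℂ}
    (hP : IsStiefel P) :
    (Pᴴ * H * P).trace.re ≤ ∑ i ∈ Finset.range k, eig H (i + 1) := by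
  obtain ⟨U, -, hU, -, hq⟩ := exists_eigenbasis_coordinates hH
  have hX := hU.mul hP
  rw [hq P, trace_conjTranspose_diagonal]
  -- The pivot is `λ_k`: zero-based position `k - 1`, shifted by one for `eig`.
  rw [← sub_nonneg, sum_range_sub_weighted hkn (fun i => eig H (i + 1)) _ hX.sum_rowWeight
    (eig H ((⟨k - 1, by omega⟩ : Fin n) + 1))]
  refine Finset.sum_nonneg fun i _ => ?_
  split_ifs with hi
  · have := eig_antitone hH (show i ≤ ⟨k - 1, by omega⟩ from Fin.mk_le_mk.mpr (by omega))
    exact mul_nonneg (sub_nonneg.mpr this) (sub_nonneg.mpr (hX.rowWeight_le_one i))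
  · have := eig_antitone hH (show ⟨k - 1, by omega⟩ ≤ i from Fin.mk_le_mk.mpr (by omega))
    exact mul_nonneg (sub_nonneg.mpr this) (rowWeight_nonneg _ i)

/-- **Ky Fan's maximum principle**, attainment with a bound for the defect in terms of the
eigengap. -/
theorem exists_kyFan_gap (hH : H.IsHermitian) (hk : 1 ≤ k) (hkn : k ≤ n) :
    ∃ V : Matrix (Fin n) (Fin k) ℂ, IsStiefel V ∧
      (Vᴴ * H * V).trace.re = ∑ i ∈ Finset.range k, eig H (i + 1) ∧
      (k < n → ∀ P : Matrix (Fin n) (Fin k) ℂ, IsStiefel P →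
        eigGap H k * (k - sqNorm (Vᴴ * P)) ≤
          ∑ i ∈ Finset.range k, eig H (i + 1) - (Pᴴ * H * P).trace.re) := by
  obtain ⟨U, hU, hU', -, hq⟩ := exists_eigenbasis_coordinates hH
  have hUV : Uᴴ * U.submatrix id (Fin.castLE hkn) =
      (1 : Matrix (Fin n) (Fin n) ℂ).submatrix id (Fin.castLE hkn) := by
    rw [← hU]; rfl
  -- The witness consists of the eigenvectors of the `k` largest eigenvalues, the first `k` columns
  -- of `U`.
  refine ⟨U.submatrix id (Fin.castLE hkn), ?_, ?_, ?_⟩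
  · have h : (U.submatrix id (Fin.castLE hkn))ᴴ * U.submatrix id (Fin.castLE hkn) =
        (Uᴴ * U).submatrix (Fin.castLE hkn) (Fin.castLE hkn) := rfl
    unfold IsStiefel
    rw [h, hU, Matrix.submatrix_one _ (Fin.castLE_injective hkn)]
  · rw [hq, trace_conjTranspose_diagonal, hUV, sum_range_eq_sum_ite hkn]
    refine Finset.sum_congr rfl fun i _ => ?_
    have : rowWeight ((1 : Matrix (Fin n) (Fin n) ℂ).submatrix id (Fin.castLE hkn)) i =
        if (i : ℕ) < k then 1 else 0 := by
      simp only [rowWeight, Matrix.submatrix_apply, id, Matrix.one_apply]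
      split_ifs with hi
      · rw [Finset.sum_eq_single ⟨i, hi⟩]
        · simp
        · intro b _ hb
          rw [if_neg]
          · simp
          · rintro h; apply hb; ext; simp [h]
        · simp
      · refine Finset.sum_eq_zero fun j _ => ?_
        rw [if_neg]
        · simp
        · rintro h; apply hi; simp [h]
    rw [this]
    split_ifs <;> simp
  · intro hlt P hP
    have hX := hU'.mul hP
    -- The overlap defect is the weight of `P` on the discarded eigenvectors; each unit of it costs
    -- at least `λ_k - λ_{k+1}`.
    have hV : (k : ℝ) - sqNorm ((U.submatrix id (Fin.castLE hkn))ᴴ * P) =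
        ∑ i : Fin n, if (i : ℕ) < k then 0 else rowWeight (Uᴴ * P) i := by
      have h1 : sqNorm ((U.submatrix id (Fin.castLE hkn))ᴴ * P) =
          ∑ i : Fin k, rowWeight (Uᴴ * P) (Fin.castLE hkn i) := rfl
      have h2 := sum_range_eq_sum_ite hkn
        (fun i => if h : i < n then rowWeight (Uᴴ * P) ⟨i, h⟩ else 0)
      have h3 : ∑ i : Fin k, rowWeight (Uᴴ * P) (Fin.castLE hkn i) =
          ∑ i ∈ Finset.range k, (if h : i < n then rowWeight (Uᴴ * P) ⟨i, h⟩ else 0) := by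
        rw [Finset.sum_range]
        refine Finset.sum_congr rfl fun i _ => ?_
        rw [dif_pos (by omega)]
        rfl
      rw [h1, h3, h2, ← hX.sum_rowWeight, ← Finset.sum_sub_distrib]
      refine Finset.sum_congr rfl fun i _ => ?_
      simp only [Fin.is_lt, dite_true]
      split_ifs <;> simp
    rw [hV, hq P, trace_conjTranspose_diagonal,
      sum_range_sub_weighted hkn (fun i => eig H (i + 1)) _ hX.sum_rowWeight
        (eig H ((⟨k - 1, by omega⟩ : Fin n) + 1)), Finset.mul_sum]
    refine Finset.sum_le_sum fun i _ => ?_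
    split_ifs with hi
    · have := eig_antitone hH (show i ≤ ⟨k - 1, by omega⟩ from Fin.mk_le_mk.mpr (by omega))
      rw [mul_zero]
      exact mul_nonneg (sub_nonneg.mpr this) (sub_nonneg.mpr (hX.rowWeight_le_one i))
    · have := eig_antitone hH (show ⟨k, hlt⟩ ≤ i from Fin.mk_le_mk.mpr (by omega))
      refine mul_le_mul_of_nonneg_right ?_ (rowWeight_nonneg _ i)
      have hk1 : k - 1 + 1 = k := by omega
      simp only [eigGap, hk1] at this ⊢
      linarith

/-- The Poincaré separation theorem in diagonal coordinates. -/
lemma separation_diagonal {d : Fin n → ℝ} {d' : Fin k → ℝ} (hkn : k ≤ n) (hd : Antitone d)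
    (hd' : Antitone d') {X : Matrix (Fin n) (Fin k) ℂ} (hX : IsStiefel X)
    (h : Xᴴ * Matrix.diagonal (fun i => (d i : ℂ)) * X = Matrix.diagonal fun i => (d' i : ℂ))
    (j : Fin k) : d' j ≤ d (Fin.castLE hkn j) := by
  -- Dimension count: the kernel of `M` contains a nonzero `x` supported on the indices `≤ j` for
  -- which `X x` vanishes in the rows before `j`. The zero row `j` makes `M` singular. Comparing the
  -- two quadratic forms at `x` gives the inequality.
  let M : Matrix (Fin k) (Fin k) ℂ := fun i l =>
    if i < j then X (Fin.castLE hkn i) l else if i = j then 0 else if i = l then 1 else 0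
  have hM : M.det = 0 := Matrix.det_eq_zero_of_row_eq_zero j fun l => by simp [M]
  obtain ⟨x, hx0, hx⟩ := Matrix.exists_mulVec_eq_zero_iff.mpr hM
  let x' : Matrix (Fin k) (Fin 1) ℂ := fun i _ => x i
  have hlow : ∀ i, i < j → (X * x') (Fin.castLE hkn i) 0 = 0 := by
    intro i hi
    have := congrFun hx i
    change ∑ l, X (Fin.castLE hkn i) l * x l = 0
    simpa [M, Matrix.mulVec, dotProduct, hi] using this
  have hhigh : ∀ i, j < i → x i = 0 := by
    intro i hi
    have := congrFun hx i
    simpa [M, Matrix.mulVec, dotProduct, hi.not_gt, hi.ne'] using this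
  have hnorm : sqNorm (X * x') = sqNorm x' := by
    have h1 : (X * x')ᴴ * (X * x') = x'ᴴ * x' := by
      rw [Matrix.conjTranspose_mul, Matrix.mul_assoc, ← Matrix.mul_assoc Xᴴ, hX, Matrix.one_mul]
    have h2 := congrArg Matrix.trace h1
    simp only [trace_conjTranspose_mul_self] at h2
    exact_mod_cast h2
  have hform : ∑ i, d i * rowWeight (X * x') i = ∑ i, d' i * rowWeight x' i := by
    rw [← trace_conjTranspose_diagonal, ← trace_conjTranspose_diagonal, ← h]
    simp only [Matrix.conjTranspose_mul, Matrix.mul_assoc]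
  have hpos : 0 < sqNorm x' := by
    refine lt_of_le_of_ne (sqNorm_nonneg _) fun h0 => hx0 ?_
    have := sqNorm_eq_zero_iff.mp h0.symm
    funext i
    exact congrFun (congrFun this i) 0
  have hle : ∑ i, d i * rowWeight (X * x') i ≤ d (Fin.castLE hkn j) * sqNorm (X * x') := by
    rw [sqNorm, Finset.mul_sum]
    refine Finset.sum_le_sum fun i _ => ?_
    change d i * rowWeight (X * x') i ≤ d (Fin.castLE hkn j) * rowWeight (X * x') i
    by_cases hi : (i : ℕ) < j
    · have h0 := hlow ⟨i, hi.trans j.2⟩ hi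
      have : rowWeight (X * x') i = 0 := by
        simp only [rowWeight, Finset.univ_unique, Finset.sum_singleton]
        change ‖(X * x') i 0‖ ^ 2 = 0
        rw [show (X * x') i 0 = 0 from h0]
        simp
      simp [this]
    · exact mul_le_mul_of_nonneg_right (hd (Fin.le_def.mpr (by simpa using hi)))
        (rowWeight_nonneg _ i)
  have hge : d' j * sqNorm x' ≤ ∑ i, d' i * rowWeight x' i := by
    rw [sqNorm, Finset.mul_sum]
    refine Finset.sum_le_sum fun i _ => ?_
    change d' j * rowWeight x' i ≤ d' i * rowWeight x' i
    by_cases hi : j < i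
    · have : rowWeight x' i = 0 := by simp [rowWeight, x', hhigh i hi]
      simp [this]
    · exact mul_le_mul_of_nonneg_right (hd' (not_lt.mp hi)) (rowWeight_nonneg _ i)
  rw [hnorm] at hle
  exact le_of_mul_le_mul_right (by linarith) hpos

lemma isHermitian_compression (hH : H.IsHermitian) (P : Matrix (Fin n) (Fin k) ℂ) :
    (Pᴴ * H * P).IsHermitian := Matrix.isHermitian_conjTranspose_mul_mul P hH

/-- The **Poincaré separation theorem**: compressing `H` to a subspace lowers the eigenvalues. -/
theorem eig_compression_le (hH : H.IsHermitian) (hkn : k ≤ n) {P : Matrix (Fin n) (Fin k) ℂ}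
    (hP : IsStiefel P) (j : Fin k) : eig (Pᴴ * H * P) (j + 1) ≤ eig H (j + 1) := by
  have hΛ := isHermitian_compression hH P
  obtain ⟨U, -, hU', -, hq⟩ := exists_eigenbasis_coordinates hH
  obtain ⟨V, hV, h⟩ := exists_spectral hΛ
  refine separation_diagonal hkn (eig_antitone hH) (eig_antitone hΛ) (hU'.mul (hP.mul hV)) ?_ j
  rw [← hq (P * V)]
  have h1 : (P * V)ᴴ * H * (P * V) = Vᴴ * (Pᴴ * H * P) * V := by
    simp only [Matrix.conjTranspose_mul, Matrix.mul_assoc]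
  have h2 : ∀ D : Matrix (Fin k) (Fin k) ℂ, Vᴴ * (V * D * Vᴴ) * V = D := by
    intro D
    rw [Matrix.mul_assoc, Matrix.mul_assoc (V * D), hV, Matrix.mul_one, ← Matrix.mul_assoc, hV,
      Matrix.one_mul]
  conv_lhs => rw [h1, h]
  exact h2 _

lemma IsTopEigenpair.trace_eq {P : Matrix (Fin n) (Fin k) ℂ} (h : IsTopEigenpair H P) :
    (Pᴴ * H * P).trace.re = ∑ i ∈ Finset.range k, eig H (i + 1) := by
  rw [trace_eq_sum_eig h.2.1]
  refine Finset.sum_congr rfl fun i hi => h.2.2 _ (by omega) ?_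
  have := Finset.mem_range.mp hi
  omega

/-- A matrix with orthonormal columns that attains Ky Fan's bound spans an invariant subspace
carrying the largest eigenvalues. -/
theorem isTopEigenpair_of_trace (hH : H.IsHermitian) (hk : 1 ≤ k) (hkn : k ≤ n)
    {P : Matrix (Fin n) (Fin k) ℂ} (hP : IsStiefel P)
    (h : ∑ i ∈ Finset.range k, eig H (i + 1) ≤ (Pᴴ * H * P).trace.re) : IsTopEigenpair H P := by
  have hΛ := isHermitian_compression hH P
  refine ⟨?_, hΛ, ?_⟩
  · obtain ⟨U, hU, hU', hs, hq⟩ := exists_eigenbasis_coordinates hH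
    have hX := hU'.mul hP
    set X := Uᴴ * P with hXdef
    set t := eig H ((⟨k - 1, by omega⟩ : Fin n) + 1) with ht
    have hterm : ∀ i : Fin n, 0 ≤ if (i : ℕ) < k then (eig H (i + 1) - t) * (1 - rowWeight X i)
        else (t - eig H (i + 1)) * rowWeight X i := by
      intro i
      split_ifs with hi
      · have := eig_antitone hH (show i ≤ ⟨k - 1, by omega⟩ from Fin.mk_le_mk.mpr (by omega))
        exact mul_nonneg (sub_nonneg.mpr this) (sub_nonneg.mpr (hX.rowWeight_le_one i))
      · have := eig_antitone hH (show ⟨k - 1, by omega⟩ ≤ i from Fin.mk_le_mk.mpr (by omega))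
        exact mul_nonneg (sub_nonneg.mpr this) (rowWeight_nonneg _ i)
    have hzero : ∀ i : Fin n, (if (i : ℕ) < k then (eig H (i + 1) - t) * (1 - rowWeight X i)
        else (t - eig H (i + 1)) * rowWeight X i) = 0 := by
      have hs0 : ∑ i : Fin n, (if (i : ℕ) < k then (eig H (i + 1) - t) * (1 - rowWeight X i)
          else (t - eig H (i + 1)) * rowWeight X i) = 0 := by
        refine le_antisymm ?_ (Finset.sum_nonneg fun i _ => hterm i)
        rw [← sum_range_sub_weighted hkn (fun i => eig H (i + 1)) _ hX.sum_rowWeight t,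
          ← trace_conjTranspose_diagonal, ← hq P]
        linarith
      intro i
      exact (Finset.sum_eq_zero_iff_of_nonneg fun i _ => hterm i).mp hs0 i (Finset.mem_univ i)
    -- Zero defect decides every eigenvector whose eigenvalue differs from `λ_k`. The weights inside
    -- the `λ_k`-eigenspace stay free, but `D` is scalar there, so `D` still commutes with the
    -- projection.
    have hw : ∀ i : Fin n, eig H (i + 1) ≠ t → rowWeight X i = 0 ∨ rowWeight X i = 1 := by
      intro i hi
      have h0 := hzero i
      split_ifs at h0
      · rcases mul_eq_zero.mp h0 with h1 | h1
        · exact absurd (sub_eq_zero.mp h1) hi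
        · right; linarith
      · rcases mul_eq_zero.mp h0 with h1 | h1
        · exact absurd (sub_eq_zero.mp h1).symm hi
        · exact Or.inl h1
    set D := Matrix.diagonal (fun i : Fin n => (eig H (i + 1) : ℂ)) with hD
    have hcomm : D * (X * Xᴴ) = X * Xᴴ * D := by
      ext i j
      rw [hD, Matrix.diagonal_mul, Matrix.mul_diagonal]
      by_cases hij : i = j
      · subst hij; ring
      by_cases hi : eig H (i + 1) = t
      · by_cases hj : eig H (j + 1) = t
        · rw [hi, hj]; ring
        · have h0 := hX.proj_apply_eq_zero (Ne.symm hij) (hw j hj)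
          have h1 : (X * Xᴴ) i j = 0 := by
            have := (Matrix.isHermitian_mul_conjTranspose_self X).apply i j
            rw [← this, h0, star_zero]
          rw [h1]; ring
      · rw [hX.proj_apply_eq_zero hij (hw i hi)]; ring
    have hDX : D * X = X * (Xᴴ * D * X) := by
      calc D * X = D * (X * Xᴴ) * X := by
            rw [Matrix.mul_assoc, Matrix.mul_assoc X, hX, Matrix.mul_one]
        _ = X * (Xᴴ * D * X) := by rw [hcomm]; simp only [Matrix.mul_assoc]
    have hUX : U * X = P := by
      rw [hXdef, ← Matrix.mul_assoc, hU.mul_conjTranspose, Matrix.one_mul]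
    calc H * P = U * (D * X) := by rw [hs]; simp only [Matrix.mul_assoc, hXdef]
      _ = P * (Pᴴ * H * P) := by rw [hDX, ← Matrix.mul_assoc, hUX, hq P]
  -- Termwise inequalities from Poincaré separation together with equal sums force termwise
  -- equality.
  · have hle : ∀ i ∈ Finset.range k, eig (Pᴴ * H * P) (i + 1) ≤ eig H (i + 1) := fun i hi =>
      eig_compression_le hH hkn hP ⟨i, Finset.mem_range.mp hi⟩
    have hsum : ∑ i ∈ Finset.range k, eig (Pᴴ * H * P) (i + 1) =
        ∑ i ∈ Finset.range k, eig H (i + 1) :=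
      le_antisymm (Finset.sum_le_sum hle) (by rwa [trace_eq_sum_eig hΛ] at h)
    intro i h1 h2
    have := (Finset.sum_eq_sum_iff_of_le hle).mp hsum (i - 1) (Finset.mem_range.mpr (by omega))
    rwa [Nat.sub_add_cancel h1] at this

/-- Matrices with orthonormal columns that span an invariant subspace for the largest eigenvalues
are exactly the maximizers of `tr(Xᴴ H X)`. -/
theorem isTopEigenpair_iff (hH : H.IsHermitian) (hk : 1 ≤ k) (hkn : k ≤ n)
    {P : Matrix (Fin n) (Fin k) ℂ} (hP : IsStiefel P) :
    IsTopEigenpair H P ↔ ∀ X : Matrix (Fin n) (Fin k) ℂ, IsStiefel X →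
      (Xᴴ * H * X).trace.re ≤ (Pᴴ * H * P).trace.re := by
  refine ⟨fun h X hX => h.trace_eq ▸ kyFan_le hH hk hkn hX, fun h => ?_⟩
  obtain ⟨V, hV, hVt, -⟩ := exists_kyFan_gap hH hk hkn
  exact isTopEigenpair_of_trace hH hk hkn hP (hVt ▸ h V hV)

lemma eigGap_nonneg (hH : H.IsHermitian) (hk : 1 ≤ k) (hlt : k < n) : 0 ≤ eigGap H k := by
  have := eig_antitone hH (show (⟨k - 1, by omega⟩ : Fin n) ≤ ⟨k, hlt⟩ from
    Fin.mk_le_mk.mpr (by omega))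
  have hk1 : k - 1 + 1 = k := by omega
  simp only [hk1] at this
  exact sub_nonneg.mpr this

/-- The gain of `tr(Xᴴ H X)` in passing from `P` to a top eigenbasis `P'` controls the distance of
the column spaces. -/
theorem IsTopEigenbasis.gap_mul_le (hH : H.IsHermitian) (hk : 1 ≤ k) (hlt : k < n)
    {P P' : Matrix (Fin n) (Fin k) ℂ} (hP' : IsTopEigenbasis H P') (hP : IsStiefel P) :
    eigGap H k * (k - sqNorm (P'ᴴ * P)) ≤ (P'ᴴ * H * P').trace.re - (Pᴴ * H * P).trace.re := by
  obtain ⟨V, hV, -, hgap⟩ := exists_kyFan_gap hH hk hlt.le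
  rw [hP'.2.trace_eq]
  -- The gap bound is stated for one particular eigenbasis `V`. With a positive gap, `P'` spans the
  -- same subspace as `V`; with a zero gap only the Ky Fan bound is needed.
  rcases (eigGap_nonneg hH hk hlt).eq_or_lt with h0 | h0
  · rw [← h0, zero_mul, sub_nonneg]
    exact kyFan_le hH hk hlt.le hP
  · have h1 := hgap hlt P' hP'.1
    rw [hP'.2.trace_eq, sub_self] at h1
    have h2 : (k : ℝ) ≤ sqNorm (Vᴴ * P') := by
      by_contra hc
      push Not at hc
      nlinarith
    obtain ⟨hQ, hVQ⟩ := hV.eq_mul_of_sqNorm hP'.1 h2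
    have h3 : P' * P'ᴴ = V * Vᴴ := by
      conv_lhs => rw [hVQ]
      exact hQ.mul_mul_conjTranspose
    rw [sqNorm_conjTranspose_mul_congr h3]
    exact hgap hlt P hP

/-- If the eigengap is positive, then the top eigenbasis is unique up to a unitary factor. -/
theorem IsTopEigenbasis.eq_mul (hH : H.IsHermitian) (hk : 1 ≤ k) (hkn : k ≤ n)
    (hgap : HasPosGap H k) {P P' : Matrix (Fin n) (Fin k) ℂ} (hP : IsTopEigenbasis H P)
    (hP' : IsTopEigenbasis H P') :
    IsStiefel (Pᴴ * P') ∧ P' = P * (Pᴴ * P') := by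
  rcases hkn.eq_or_lt with rfl | hlt
  · exact hP.1.eq_mul_of_square hP'.1
  · refine hP.1.eq_mul_of_sqNorm hP'.1 ?_
    have h1 := hP.gap_mul_le hH hk hlt hP'.1
    rw [hP.2.trace_eq, hP'.2.trace_eq, sub_self] at h1
    by_contra hc
    push Not at hc
    nlinarith [hgap hlt]

end KyFan

/-! ### Canonical angles and residuals -/

section SinTheta

variable {n k : ℕ}

lemma symmetric_eigenvalues_congr {E : Type*} [NormedAddCommGroup E] [InnerProductSpace ℂ E]
    [FiniteDimensional ℂ E] {d : ℕ} (hd : Module.finrank ℂ E = d) {S T : E →ₗ[ℂ] E}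
    (hS : S.IsSymmetric) (hT : T.IsSymmetric) (h : S = T) :
    hS.eigenvalues hd = hT.eigenvalues hd := by
  subst h; rfl

lemma sq_singularValues_eq_eig (A : Matrix (Fin k) (Fin k) ℂ) (i : Fin k) :
    (Matrix.toEuclideanLin A).singularValues i ^ 2 = eig (Aᴴ * A) (i + 1) := by
  have hH := Matrix.isHermitian_conjTranspose_mul_self A
  have hc : LinearMap.adjoint (Matrix.toEuclideanLin A) ∘ₗ Matrix.toEuclideanLin A =
      Matrix.toEuclideanLin (Aᴴ * A) := by
    rw [← Matrix.toEuclideanLin_conjTranspose_eq_adjoint]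
    ext x
    simp [Matrix.toLpLin_apply, Matrix.mulVec_mulVec]
  rw [eig_succ hH, (Matrix.toEuclideanLin A).sq_singularValues_of_lt
    (n := Fintype.card (Fin k)) finrank_euclideanSpace (by simp)]
  exact congrFun (symmetric_eigenvalues_congr finrank_euclideanSpace _
    (Matrix.isSymmetric_toEuclideanLin_iff.mpr hH) hc) _

/-- Testing the contraction on the `i`-th unit eigenvector of `Aᴴ A` gives the eigenvalue itself.
This keeps the cosines of the canonical angles in `[0, 1]`. -/
lemma eig_conjTranspose_mul_self_le_one {A : Matrix (Fin k) (Fin k) ℂ}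
    (hA : ∀ x : Matrix (Fin k) (Fin 1) ℂ, sqNorm (A * x) ≤ sqNorm x) (i : Fin k) :
    eig (Aᴴ * A) (i + 1) ≤ 1 := by
  obtain ⟨U, hU, h⟩ := exists_spectral (Matrix.isHermitian_conjTranspose_mul_self A)
  have hd : Uᴴ * (Aᴴ * A) * U =
      Matrix.diagonal (fun i : Fin k => (eig (Aᴴ * A) (i + 1) : ℂ)) := by
    conv_lhs => rw [h]
    rw [Matrix.mul_assoc, Matrix.mul_assoc (U * _), hU, Matrix.mul_one, ← Matrix.mul_assoc, hU,
      Matrix.one_mul]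
  let u : Matrix (Fin k) (Fin 1) ℂ := U.submatrix id fun _ => i
  have h1 : (A * u)ᴴ * (A * u) = (Uᴴ * (Aᴴ * A) * U).submatrix (fun _ => i) (fun _ => i) := by
    rw [Matrix.conjTranspose_mul, Matrix.mul_assoc, ← Matrix.mul_assoc Aᴴ, ← Matrix.mul_assoc]
    rfl
  have h2 : uᴴ * u = (Uᴴ * U).submatrix (fun _ => i) (fun _ => i) := rfl
  have h3 := congrArg Matrix.trace h1
  have h4 := congrArg Matrix.trace h2
  rw [trace_conjTranspose_mul_self, hd] at h3
  rw [trace_conjTranspose_mul_self, hU] at h4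
  simp [Matrix.trace] at h3 h4
  have h5 := hA u
  have h3' : sqNorm (A * u) = eig (Aᴴ * A) (i + 1) := by exact_mod_cast h3
  have h4' : sqNorm u = 1 := by exact_mod_cast h4
  rwa [h3', h4'] at h5

/-- The sine distance of two column spaces in terms of the overlap of the bases. -/
theorem sinThetaFrob_sq {X Y : Matrix (Fin n) (Fin k) ℂ} (hX : IsStiefel X) (hY : IsStiefel Y) :
    sinThetaFrob X Y ^ 2 = k - sqNorm (Xᴴ * Y) := by
  have hone : ∀ x : Matrix (Fin k) (Fin 1) ℂ, sqNorm (Xᴴ * Y * x) ≤ sqNorm x := by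
    intro x
    rw [Matrix.mul_assoc]
    refine (hX.sqNorm_conjTranspose_mul_le _).trans (le_of_eq ?_)
    have h1 : (Y * x)ᴴ * (Y * x) = xᴴ * x := by
      rw [Matrix.conjTranspose_mul, Matrix.mul_assoc, ← Matrix.mul_assoc Yᴴ, hY, Matrix.one_mul]
    have h2 := congrArg Matrix.trace h1
    simp only [trace_conjTranspose_mul_self] at h2
    exact_mod_cast h2
  have hterm : ∀ i : Fin k, Real.sin (canonicalAngle X Y i) ^ 2 =
      1 - eig ((Xᴴ * Y)ᴴ * (Xᴴ * Y)) (i + 1) := by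
    intro i
    rw [canonicalAngle, Real.sin_arccos, sq_singularValues_eq_eig, Real.sq_sqrt]
    exact sub_nonneg.mpr (eig_conjTranspose_mul_self_le_one hone i)
  rw [sinThetaFrob, Real.sq_sqrt (by positivity), Finset.sum_congr rfl fun i _ => hterm i,
    Finset.sum_sub_distrib]
  have h := trace_eq_sum_eig (Matrix.isHermitian_conjTranspose_mul_self (Xᴴ * Y))
  rw [trace_conjTranspose_mul_self, Complex.ofReal_re, Finset.sum_range] at h
  rw [h]
  simp

/-- The residual of `P` is controlled by the distance of its column space from an invariant
subspace. -/
theorem sqNorm_residual_le {H : Matrix (Fin n) (Fin n) ℂ} (hH : H.IsHermitian)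
    {P P' : Matrix (Fin n) (Fin k) ℂ} (hP : IsStiefel P) (hP' : IsStiefel P')
    (hinv : H * P' = P' * (P'ᴴ * H * P')) :
    sqNorm (H * P - P * (Pᴴ * H * P)) ≤ 4 * (k - sqNorm (P'ᴴ * P)) * sqNorm H := by
  have hinv' : P'ᴴ * H = P'ᴴ * H * P' * P'ᴴ := by
    have := congrArg Matrix.conjTranspose hinv
    simpa only [Matrix.conjTranspose_mul, Matrix.conjTranspose_conjTranspose, hH.eq,
      Matrix.mul_assoc] using this
  -- Write `HP = P'P'ᴴHP + H(P - P'P'ᴴP)`, using that `H` commutes with `P'P'ᴴ`, and apply `1 -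
  -- PPᴴ`. Each of the two parts carries one factor measuring the distance of the subspaces; with
  -- the 2 from `sqNorm_add_le` this gives the constant 4.
  have hsplit : H * P - P * (Pᴴ * H * P) =
      (P' - P * (Pᴴ * P')) * (P'ᴴ * (H * P)) +
        (H * (P - P' * (P'ᴴ * P)) - P * (Pᴴ * (H * (P - P' * (P'ᴴ * P))))) := by
    have h1 : P' * (P'ᴴ * (H * P)) = H * (P' * (P'ᴴ * P)) := by
      calc P' * (P'ᴴ * (H * P)) = P' * ((P'ᴴ * H) * P) := by rw [Matrix.mul_assoc]
        _ = P' * (P'ᴴ * H * P') * (P'ᴴ * P) := by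
          rw [congrArg (· * P) hinv']; simp only [Matrix.mul_assoc]
        _ = H * (P' * (P'ᴴ * P)) := by rw [← hinv, Matrix.mul_assoc]
    rw [Matrix.sub_mul, Matrix.mul_assoc P, Matrix.mul_assoc Pᴴ P', h1]
    simp only [Matrix.mul_sub, Matrix.mul_assoc]
    abel
  have hHP : sqNorm (H * P) ≤ sqNorm H := by
    rw [← sqNorm_conjTranspose (H * P), Matrix.conjTranspose_mul, hH.eq]
    exact hP.sqNorm_conjTranspose_mul_le H
  have hsym : sqNorm (Pᴴ * P') = sqNorm (P'ᴴ * P) := by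
    rw [← sqNorm_conjTranspose (Pᴴ * P'), Matrix.conjTranspose_mul,
      Matrix.conjTranspose_conjTranspose]
  have h1 : sqNorm ((P' - P * (Pᴴ * P')) * (P'ᴴ * (H * P))) ≤
      (k - sqNorm (P'ᴴ * P)) * sqNorm H := by
    refine (sqNorm_mul_le _ _).trans ?_
    rw [← hsym, ← hP'.sqNorm_eq, ← hP.sqNorm_sub P']
    exact mul_le_mul_of_nonneg_left ((hP'.sqNorm_conjTranspose_mul_le _).trans hHP)
      (sqNorm_nonneg _)
  have h2 : sqNorm (H * (P - P' * (P'ᴴ * P)) - P * (Pᴴ * (H * (P - P' * (P'ᴴ * P))))) ≤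
      (k - sqNorm (P'ᴴ * P)) * sqNorm H := by
    refine (hP.sqNorm_proj_le _).trans ((sqNorm_mul_le _ _).trans ?_)
    rw [hP'.sqNorm_sub P, hP.sqNorm_eq, mul_comm]
  rw [hsplit]
  refine (sqNorm_add_le _ _).trans ?_
  linarith

end SinTheta

/-! ### Kronecker products of families -/

section Kronecker

variable {ι : Type} [Fintype ι] {n p q : ι → ℕ}

/-- The Kronecker product of a family of matrices. -/
noncomputable def kron (X : ∀ ℓ, Matrix (Fin (p ℓ)) (Fin (n ℓ)) ℂ) :
    Matrix (∀ ℓ, Fin (p ℓ)) (∀ ℓ, Fin (n ℓ)) ℂ :=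
  fun i j => ∏ ℓ, X ℓ (i ℓ) (j ℓ)

lemma kron_mul [DecidableEq ι] (X : ∀ ℓ, Matrix (Fin (p ℓ)) (Fin (q ℓ)) ℂ)
    (Y : ∀ ℓ, Matrix (Fin (q ℓ)) (Fin (n ℓ)) ℂ) :
    kron X * kron Y = kron fun ℓ => X ℓ * Y ℓ := by
  ext i j
  simp only [kron, Matrix.mul_apply, ← Finset.prod_mul_distrib]
  rw [Finset.prod_univ_sum, Fintype.piFinset_univ]

lemma kron_conjTranspose (X : ∀ ℓ, Matrix (Fin (p ℓ)) (Fin (n ℓ)) ℂ) :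
    (kron X)ᴴ = kron fun ℓ => (X ℓ)ᴴ := by
  ext i j
  simp [kron, Matrix.conjTranspose_apply]

lemma kron_transpose (X : ∀ ℓ, Matrix (Fin (p ℓ)) (Fin (n ℓ)) ℂ) :
    (kron X)ᵀ = kron fun ℓ => (X ℓ)ᵀ := by
  ext i j
  simp [kron, Matrix.transpose_apply]

end Kronecker

/-! ### The objective as a trace, continuity and compactness -/

section Objective

variable {m : ℕ} {n k : Fin m → ℕ}

lemma matC_eq (B : Tensor n) (P : Factors n k) (ℓ : Fin m) :
    matC B P ℓ = unfold B ℓ * (kron fun r : {r // r ≠ ℓ} => (P r)ᴴ)ᵀ := by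
  ext a c
  simp only [matC, multiModeMul, Matrix.mul_apply, Matrix.transpose_apply, kron]
  exact Finset.sum_congr rfl fun _ _ => mul_comm _ _

/-- `H_ℓ` depends on the factors only through the projections onto their column spaces. -/
lemma matH_eq (B : Tensor n) (P : Factors n k) (ℓ : Fin m) :
    matH B P ℓ = unfold B ℓ * kron (fun r : {r // r ≠ ℓ} => (P r * (P r)ᴴ)ᵀ) * (unfold B ℓ)ᴴ := by
  rw [matH, matC_eq, Matrix.conjTranspose_mul, Matrix.mul_assoc, Matrix.mul_assoc,
    ← Matrix.mul_assoc _ _ (unfold B ℓ)ᴴ, kron_transpose, kron_conjTranspose, kron_mul]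
  have : ∀ r : {r // r ≠ ℓ}, (P r)ᴴᵀ * (P r)ᴴᵀᴴ = (P r * (P r)ᴴ)ᵀ := by
    intro r
    rw [Matrix.transpose_mul]
    congr 1
    ext i j
    simp
  simp only [this]

lemma matH_congr (B : Tensor n) {P P' : Factors n k} {ℓ : Fin m}
    (h : ∀ r, r ≠ ℓ → P r * (P r)ᴴ = P' r * (P' r)ᴴ) : matH B P ℓ = matH B P' ℓ := by
  rw [matH_eq, matH_eq]
  congr 3
  funext r
  rw [h r r.2]

lemma matH_isHermitian (B : Tensor n) (P : Factors n k) (ℓ : Fin m) :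
    (matH B P ℓ).IsHermitian := Matrix.isHermitian_mul_conjTranspose_self _

/-- Unfolding only rearranges entries, and the factor of mode `ℓ` splits off from the product over
modes. -/
lemma objective_eq_sqNorm (B : Tensor n) (P : Factors n k) (ℓ : Fin m) :
    objective B P = sqNorm ((P ℓ)ᴴ * matC B P ℓ) := by
  have hentry : ∀ (b : Fin (k ℓ)) (c : ∀ r : {r // r ≠ ℓ}, Fin (k r)),
      multiModeMul B (fun ℓ => (P ℓ)ᴴ) ((Equiv.piSplitAt ℓ fun r => Fin (k r)).symm (b, c)) =
        ((P ℓ)ᴴ * matC B P ℓ) b c := by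
    intro b c
    simp only [multiModeMul, Matrix.mul_apply, matC, Finset.mul_sum]
    rw [← (Equiv.piSplitAt ℓ fun r => Fin (n r)).symm.sum_comp, Fintype.sum_prod_type]
    refine Finset.sum_congr rfl fun a _ => Finset.sum_congr rfl fun d _ => ?_
    rw [Fintype.prod_eq_mul_prod_subtype_ne _ ℓ, mul_assoc]
    congr 1
    · simp [Equiv.piSplitAt]
    · congr 1
      refine Finset.prod_congr rfl fun r _ => ?_
      simp [Equiv.piSplitAt, r.2]
  rw [objective, tensorFrob, Real.sq_sqrt (by positivity),
    ← (Equiv.piSplitAt ℓ fun r => Fin (k r)).symm.sum_comp, Fintype.sum_prod_type, sqNorm]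
  simp only [hentry]

lemma objective_eq_trace (B : Tensor n) (P : Factors n k) (ℓ : Fin m) :
    objective B P = ((P ℓ)ᴴ * matH B P ℓ * P ℓ).trace.re := by
  rw [objective_eq_sqNorm B P ℓ, ← sqNorm_conjTranspose, ← Complex.ofReal_re (sqNorm _),
    ← trace_conjTranspose_mul_self]
  simp only [matH, Matrix.conjTranspose_mul, Matrix.conjTranspose_conjTranspose, Matrix.mul_assoc]

lemma continuous_matH (B : Tensor n) (ℓ : Fin m) :
    Continuous fun P : Factors n k => matH B P ℓ := by
  have : Continuous fun P : Factors n k =>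
      kron (fun r : {r // r ≠ ℓ} => (P r * (P r)ᴴ)ᵀ) := by
    refine continuous_matrix fun i j => continuous_finsetProd _ fun r _ => ?_
    have h : Continuous fun P : Factors n k => (P r * (P r)ᴴ)ᵀ :=
      ((continuous_apply _).matrix_mul (continuous_apply _).matrix_conjTranspose).matrix_transpose
    exact h.matrix_elem _ _
  simp only [matH_eq]
  exact (continuous_const.matrix_mul this).matrix_mul continuous_const

lemma continuous_objective (B : Tensor n) : Continuous fun P : Factors n k => objective B P := by
  unfold objective tensorFrob multiModeMul
  refine (Real.continuous_sqrt.comp (continuous_finsetSum _ fun i _ =>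
    (continuous_norm.comp (continuous_finsetSum _ fun j _ => ?_)).pow 2)).pow 2
  refine Continuous.mul (continuous_finsetProd _ fun r _ => ?_) continuous_const
  exact (continuous_apply r).matrix_conjTranspose.matrix_elem _ _

/-- The tuple `(P'_1, …, P'_t, P_{t+1}, …, P_m)`. -/
def stage (P' P : Factors n k) (t : ℕ) : Factors n k := fun r => if (r : ℕ) < t then P' r else P r

lemma stage_zero (P' P : Factors n k) : stage P' P 0 = P := by
  funext r; simp [stage]

lemma stage_of_le (P' P : Factors n k) {t : ℕ} (ht : m ≤ t) : stage P' P t = P' := by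
  funext r; simp [stage, r.2.trans_le ht]

lemma mix_eq_stage (P' P : Factors n k) (ℓ : Fin m) : mix P' P ℓ = stage P' P ℓ := by
  rfl

lemma mixH_isHermitian (B : Tensor n) (P' P : Factors n k) (ℓ : Fin m) :
    (mixH B P' P ℓ).IsHermitian := matH_isHermitian _ _ _

lemma objective_stage (B : Tensor n) (P' P : Factors n k) (ℓ : Fin m) :
    objective B (stage P' P ℓ) = ((P ℓ)ᴴ * mixH B P' P ℓ * P ℓ).trace.re := by
  have h : stage P' P ℓ ℓ = P ℓ := by simp [stage]
  rw [objective_eq_trace B _ ℓ, mixH, mix_eq_stage, h]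

/-- `H_ℓ` does not involve the `ℓ`-th factor, so the same matrix gives the objective before and
after substep `ℓ`. As `ℓ` is zero-based, `stage P' P ℓ` is the tuple just before that substep. -/
lemma objective_stage_succ (B : Tensor n) (P' P : Factors n k) (ℓ : Fin m) :
    objective B (stage P' P (ℓ + 1)) = ((P' ℓ)ᴴ * mixH B P' P ℓ * P' ℓ).trace.re := by
  have h : stage P' P (ℓ + 1) ℓ = P' ℓ := by simp [stage]
  have hH : matH B (stage P' P (ℓ + 1)) ℓ = matH B (stage P' P ℓ) ℓ := by
    refine matH_congr B fun r hr => ?_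
    have : (r : ℕ) < ℓ + 1 ↔ (r : ℕ) < ℓ := by
      have := Fin.val_ne_of_ne hr
      omega
    simp only [stage, this]
  rw [objective_eq_trace B _ ℓ, mixH, mix_eq_stage, h, hH]

lemma continuous_mixH (B : Tensor n) (ℓ : Fin m) :
    Continuous fun x : Factors n k × Factors n k => mixH B x.1 x.2 ℓ := by
  refine (continuous_matH B ℓ).comp (continuous_pi fun r => ?_)
  unfold mix
  split_ifs
  · exact (continuous_apply r).comp continuous_fst
  · exact (continuous_apply r).comp continuous_snd

/-- The tuples whose components have orthonormal columns. -/
def stiefelTuples (n k : Fin m → ℕ) : Set (Factors n k) := {P | ∀ ℓ, IsStiefel (P ℓ)}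

lemma isClosed_isStiefel (a b : ℕ) : IsClosed {P : Matrix (Fin a) (Fin b) ℂ | IsStiefel P} :=
  isClosed_eq (continuous_id.matrix_conjTranspose.matrix_mul continuous_id) continuous_const

lemma isCompact_isStiefel (a b : ℕ) : IsCompact {P : Matrix (Fin a) (Fin b) ℂ | IsStiefel P} := by
  -- The squared entries sum to `b`, so each entry has modulus at most `√b ≤ b + 1`.
  have hK : IsCompact (Set.univ.pi fun _ : Fin a => Set.univ.pi fun _ : Fin b =>
      Metric.closedBall (0 : ℂ) (b + 1)) :=
    isCompact_univ_pi fun _ => isCompact_univ_pi fun _ => isCompact_closedBall _ _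
  refine IsCompact.of_isClosed_subset hK (isClosed_isStiefel a b) ?_
  intro P hP i _ j _
  have h1 : ‖P i j‖ ^ 2 ≤ sqNorm P :=
    (Finset.single_le_sum (f := fun j => ‖P i j‖ ^ 2) (fun _ _ => by positivity)
      (Finset.mem_univ j)).trans
      (Finset.single_le_sum (f := fun i => ∑ j, ‖P i j‖ ^ 2) (fun _ _ => by positivity)
        (Finset.mem_univ i))
  rw [IsStiefel.sqNorm_eq hP] at h1
  rw [mem_closedBall_zero_iff]
  nlinarith [norm_nonneg (P i j), (Nat.cast_nonneg b : (0 : ℝ) ≤ b)]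

lemma isCompact_stiefelTuples (n k : Fin m → ℕ) : IsCompact (stiefelTuples n k) := by
  have : stiefelTuples n k =
      Set.univ.pi fun ℓ => {P : Matrix (Fin (n ℓ)) (Fin (k ℓ)) ℂ | IsStiefel P} := by
    ext P; simp [stiefelTuples]
  rw [this]
  exact isCompact_univ_pi fun ℓ => isCompact_isStiefel _ _

end Objective

/-! ### Convergence to an isolated accumulation point -/

section Isolated

/-- If a sequence in a compact set has an isolated accumulation point `y`, and the successors of
the terms close to `y` are again close to `y`, then the sequence converges to `y`. -/
theorem tendsto_of_isIsolatedAccPt {X : Type} [TopologicalSpace X] [RegularSpace X] {s : ℕ → X}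
    {y : X} {K : Set X} (hK : IsCompact K) (hs : ∀ j, s j ∈ K) (hy : IsIsolatedAccPt s y)
    (hsucc : ∀ u : Ultrafilter ℕ, (u : Filter ℕ) ≤ atTop → Tendsto s u (𝓝 y) →
      Tendsto (fun j => s (j + 1)) u (𝓝 y)) :
    Tendsto s atTop (𝓝 y) := by
  obtain ⟨hcl, U, hU, hiso⟩ := hy
  obtain ⟨C, hC, hCc, hCU⟩ := exists_mem_nhds_isClosed_subset hU
  -- Compactness provides a limit along `u`; it lies in the closed set `C ⊆ U`, where `y` is the
  -- only accumulation point.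
  have hlim : ∀ u : Ultrafilter ℕ, (u : Filter ℕ) ≤ atTop → (∀ᶠ j in u, s j ∈ C) →
      Tendsto s u (𝓝 y) := by
    intro u hu huC
    obtain ⟨z, -, hz⟩ := hK.ultrafilter_le_nhds (u.map s)
      (le_principal_iff.mpr (Eventually.of_forall hs : ∀ᶠ j in (u : Filter ℕ), s j ∈ K))
    have hz' : Tendsto s u (𝓝 z) := hz
    have hzC : z ∈ C := hCc.mem_of_tendsto hz' huC
    rwa [← hiso z (hCU hzC) (mapClusterPt_iff_ultrafilter.mpr ⟨u, hu, hz'⟩)]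
  -- If the sequence left `C` infinitely often, an ultrafilter on the exit times would send `s j`,
  -- hence `s (j + 1)`, to `y`, contradicting the exits.
  have hstay : ∀ᶠ j in atTop, s j ∈ C → s (j + 1) ∈ C := by
    by_contra hc
    have hf : ∃ᶠ j in atTop, j ∈ {j | s j ∈ C ∧ s (j + 1) ∉ C} := by
      refine (not_eventually.mp hc).mono fun j hj => ?_
      simpa using hj
    have := frequently_mem_iff_neBot.mp hf
    have hu := Ultrafilter.of_le (atTop ⊓ 𝓟 {j | s j ∈ C ∧ s (j + 1) ∉ C})
    set u := Ultrafilter.of (atTop ⊓ 𝓟 {j | s j ∈ C ∧ s (j + 1) ∉ C})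
    have hmem : ∀ᶠ j in (u : Filter ℕ), s j ∈ C ∧ s (j + 1) ∉ C :=
      le_principal_iff.mp (hu.trans inf_le_right)
    have htop := hu.trans inf_le_left
    have h1 := hsucc u htop (hlim u htop (hmem.mono fun _ h => h.1))
    obtain ⟨j, hj1, hj2⟩ := ((h1.eventually_mem hC).and hmem).exists
    exact hj2.2 hj1
  have hin : ∀ᶠ j in atTop, s j ∈ C := by
    obtain ⟨N, hN⟩ := eventually_atTop.mp hstay
    obtain ⟨M, hM, hMC⟩ := frequently_atTop.mp (hcl.frequently hC) N
    refine eventually_atTop.mpr ⟨M, fun j hj => ?_⟩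
    induction j, hj using Nat.le_induction with
    | base => exact hMC
    | succ j hj ih => exact hN j (hM.trans hj) ih
  exact tendsto_iff_ultrafilter _ _ _ |>.mpr fun u hu => hlim u hu (hu hin)

end Isolated

/-! ### Limits of matrix expressions -/

section Limits

variable {ι : Type*} {u : Filter ι} {α β γ : Type*}

lemma tendsto_matrix_mul [Fintype β] {X : ι → Matrix α β ℂ} {Y : ι → Matrix β γ ℂ} {x : Matrix α β ℂ}
    {y : Matrix β γ ℂ} (hX : Tendsto X u (𝓝 x)) (hY : Tendsto Y u (𝓝 y)) :
    Tendsto (fun j => X j * Y j) u (𝓝 (x * y)) := by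
  have hc : Continuous fun z : Matrix α β ℂ × Matrix β γ ℂ => z.1 * z.2 :=
    continuous_fst.matrix_mul continuous_snd
  have h := (hc.tendsto (x, y)).comp (hX.prodMk_nhds hY)
  exact h

lemma tendsto_conjTranspose {X : ι → Matrix α β ℂ} {x : Matrix α β ℂ}
    (hX : Tendsto X u (𝓝 x)) : Tendsto (fun j => (X j)ᴴ) u (𝓝 xᴴ) := by
  have hc : Continuous fun z : Matrix α β ℂ => zᴴ := continuous_id.matrix_conjTranspose
  exact (hc.tendsto x).comp hX

lemma tendsto_trace_re [Fintype β] [Fintype γ] {A : ι → Matrix β β ℂ} {X : ι → Matrix β γ ℂ}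
    {a : Matrix β β ℂ} {x : Matrix β γ ℂ} (hA : Tendsto A u (𝓝 a)) (hX : Tendsto X u (𝓝 x)) :
    Tendsto (fun j => ((X j)ᴴ * A j * X j).trace.re) u (𝓝 (xᴴ * a * x).trace.re) := by
  have hc : Continuous fun z : Matrix γ γ ℂ => z.trace.re :=
    Complex.continuous_re.comp continuous_id.matrix_trace
  have h := (hc.tendsto _).comp
    (tendsto_matrix_mul (tendsto_matrix_mul (tendsto_conjTranspose hX) hA) hX)
  exact h

end Limits

/-! ### Positive semidefinite matrices -/

section Polar

variable {k : ℕ}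

/-- `Γ + 1` is positive definite, hence invertible, and annihilates `Γ - 1`. -/
lemma eq_one_of_posSemidef_of_sq {Γ : Matrix (Fin k) (Fin k) ℂ} (h : Γ.PosSemidef)
    (h2 : Γ * Γ = 1) : Γ = 1 := by
  have hpd : (Γ + 1).PosDef := Matrix.PosDef.posSemidef_add h Matrix.PosDef.one
  have h0 : (Γ + 1) * (Γ - 1) = 0 := by
    rw [Matrix.add_mul, Matrix.mul_sub, h2, Matrix.mul_one, Matrix.one_mul]
    abel
  have h1 : Γ - 1 = 0 := by
    obtain ⟨v, hv⟩ := hpd.isUnit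
    rw [← hv] at h0
    exact (Units.mul_right_eq_zero v).mp h0
  exact sub_eq_zero.mp h1

lemma isClosed_posSemidef : IsClosed {Γ : Matrix (Fin k) (Fin k) ℂ | Γ.PosSemidef} := by
  have : {Γ : Matrix (Fin k) (Fin k) ℂ | Γ.PosSemidef} =
      {Γ | Γᴴ = Γ} ∩ ⋂ x : Fin k → ℂ, {Γ | 0 ≤ star x ⬝ᵥ (Γ *ᵥ x)} := by
    ext Γ
    simp [Matrix.posSemidef_iff_dotProduct_mulVec, Matrix.IsHermitian]
  rw [this]
  refine (isClosed_eq continuous_id.matrix_conjTranspose continuous_id).inter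
    (isClosed_iInter fun x => isClosed_le continuous_const ?_)
  exact continuous_const.dotProduct (continuous_id.matrix_mulVec continuous_const)

end Polar

/-! ### One sweep of the iteration -/

section Sweep

lemma sqNorm_conjTranspose_mul_of_eq {a b : ℕ} (h : b = a) {X Y : Matrix (Fin a) (Fin b) ℂ}
    (hX : IsStiefel X) (hY : IsStiefel Y) : sqNorm (Xᴴ * Y) = b := by
  subst h
  exact (hX.eq_mul_of_square hY).1.sqNorm_eq

variable {m : ℕ} {n k : Fin m → ℕ} {B : Tensor n}

/-- `P'` arises from `P` by one sweep of the higher-order orthogonal iteration. -/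
def IsSweep (B : Tensor n) (P P' : Factors n k) : Prop :=
  ∀ ℓ, IsTopEigenbasis (mixH B P' P ℓ) (P' ℓ)

lemma IsSweep.objective_stage_le_succ (hk : ∀ ℓ, 1 ≤ k ℓ) (hkn : ∀ ℓ, k ℓ ≤ n ℓ)
    {P P' : Factors n k} (hP : P ∈ stiefelTuples n k) (h : IsSweep B P P') (ℓ : Fin m) :
    objective B (stage P' P ℓ) ≤ objective B (stage P' P (ℓ + 1)) := by
  rw [objective_stage, objective_stage_succ, (h ℓ).2.trace_eq]
  exact kyFan_le (mixH_isHermitian _ _ _ _) (hk ℓ) (hkn ℓ) (hP ℓ)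

/-- The objective increases along the substeps of a sweep. -/
lemma IsSweep.monotone_objective_stage (hk : ∀ ℓ, 1 ≤ k ℓ) (hkn : ∀ ℓ, k ℓ ≤ n ℓ)
    {P P' : Factors n k} (hP : P ∈ stiefelTuples n k) (h : IsSweep B P P') :
    Monotone fun t => objective B (stage P' P t) := by
  refine monotone_nat_of_le_succ fun t => ?_
  by_cases ht : t < m
  · exact h.objective_stage_le_succ hk hkn hP ⟨t, ht⟩
  · rw [stage_of_le _ _ (by omega), stage_of_le _ _ (by omega)]

lemma IsSweep.objective_le (hk : ∀ ℓ, 1 ≤ k ℓ) (hkn : ∀ ℓ, k ℓ ≤ n ℓ)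
    {P P' : Factors n k} (hP : P ∈ stiefelTuples n k) (h : IsSweep B P P') :
    objective B P ≤ objective B P' := by
  have := h.monotone_objective_stage hk hkn hP (Nat.zero_le m)
  simpa only [stage_zero, stage_of_le _ _ le_rfl] using this

/-- All substep gains are nonnegative, so none exceeds their total. -/
lemma IsSweep.substep_gain_le (hk : ∀ ℓ, 1 ≤ k ℓ) (hkn : ∀ ℓ, k ℓ ≤ n ℓ)
    {P P' : Factors n k} (hP : P ∈ stiefelTuples n k) (h : IsSweep B P P') (ℓ : Fin m) :
    objective B (stage P' P (ℓ + 1)) - objective B (stage P' P ℓ) ≤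
      objective B P' - objective B P := by
  have h1 := h.monotone_objective_stage hk hkn hP (Nat.zero_le ℓ)
  have h2 := h.monotone_objective_stage hk hkn hP (Nat.succ_le_of_lt ℓ.2)
  simp only [stage_zero, stage_of_le _ _ le_rfl, Nat.succ_eq_add_one] at h1 h2
  linarith

/-- If a sweep does not increase the objective, then the old factors already carry the largest
eigenvalues. -/
theorem IsSweep.isTopEigenpair (hk : ∀ ℓ, 1 ≤ k ℓ) (hkn : ∀ ℓ, k ℓ ≤ n ℓ)
    {P P' : Factors n k} (hP : P ∈ stiefelTuples n k) (h : IsSweep B P P')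
    (heq : objective B P' = objective B P) (ℓ : Fin m) :
    IsTopEigenpair (mixH B P' P ℓ) (P ℓ) := by
  have h1 := h.substep_gain_le hk hkn hP ℓ
  refine isTopEigenpair_of_trace (mixH_isHermitian _ _ _ _) (hk ℓ) (hkn ℓ) (hP ℓ) ?_
  rw [← (h ℓ).2.trace_eq, ← objective_stage, ← objective_stage_succ]
  linarith

lemma mixH_eq_matH {P P' : Factors n k} {ℓ : Fin m}
    (h : ∀ r < ℓ, P' r * (P' r)ᴴ = P r * (P r)ᴴ) : mixH B P' P ℓ = matH B P ℓ := by
  refine matH_congr B fun r _ => ?_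
  unfold mix
  split_ifs with hr
  · exact h r hr
  · rfl

/-- If a sweep does not increase the objective and the eigengaps are positive, then it only changes
the bases of the column spaces. -/
theorem IsSweep.eq_mul (hk : ∀ ℓ, 1 ≤ k ℓ) (hkn : ∀ ℓ, k ℓ ≤ n ℓ)
    {P P' : Factors n k} (hP : P ∈ stiefelTuples n k) (h : IsSweep B P P')
    (heq : objective B P' = objective B P) (ℓ : Fin m)
    (hgap : ∀ r ≤ ℓ, HasPosGap (matH B P r) (k r)) :
    IsStiefel ((P ℓ)ᴴ * P' ℓ) ∧ P' ℓ = P ℓ * ((P ℓ)ᴴ * P' ℓ) := by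
  induction ℓ using WellFoundedLT.induction with
  | ind ℓ ih =>
    -- The earlier factors were only rotated, so the gap assumed for `matH` applies to `mixH`.
    have hH : mixH B P' P ℓ = matH B P ℓ := mixH_eq_matH fun r hr => by
      obtain ⟨h1, h2⟩ := ih r hr fun r' hr' => hgap r' (hr'.trans hr.le)
      conv_lhs => rw [h2]
      exact h1.mul_mul_conjTranspose
    refine IsTopEigenbasis.eq_mul (mixH_isHermitian B P' P ℓ) (hk ℓ) (hkn ℓ) (hH ▸ hgap ℓ le_rfl)
      ⟨hP ℓ, h.isTopEigenpair hk hkn hP heq ℓ⟩ (h ℓ)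

/-- Limits of sweeps are sweeps. -/
theorem IsSweep.of_tendsto (hk : ∀ ℓ, 1 ≤ k ℓ) (hkn : ∀ ℓ, k ℓ ≤ n ℓ) {u : Filter ℕ} [u.NeBot]
    {X X' : ℕ → Factors n k} {P P' : Factors n k} (h : ∀ j, IsSweep B (X j) (X' j))
    (hX : Tendsto X u (𝓝 P)) (hX' : Tendsto X' u (𝓝 P')) : IsSweep B P P' := by
  intro ℓ
  have hX'ℓ : Tendsto (fun j => X' j ℓ) u (𝓝 (P' ℓ)) := tendsto_pi_nhds.mp hX' ℓ
  have hst : IsStiefel (P' ℓ) :=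
    (isClosed_isStiefel _ _).mem_of_tendsto hX'ℓ (Eventually.of_forall fun j => (h j ℓ).1)
  -- The variational form turns the claim into trace inequalities, which pass to the limit without
  -- any continuity of eigenvalues.
  refine ⟨hst, (isTopEigenpair_iff (mixH_isHermitian _ _ _ _) (hk ℓ) (hkn ℓ) hst).mpr
    fun Y hY => ?_⟩
  have hH : Tendsto (fun j => mixH B (X' j) (X j) ℓ) u (𝓝 (mixH B P' P ℓ)) :=
    have h := ((continuous_mixH B ℓ).tendsto (P', P)).comp (hX'.prodMk_nhds hX)
    h
  have h1 := tendsto_trace_re hH (tendsto_const_nhds (x := Y))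
  have h2 := tendsto_trace_re hH hX'ℓ
  exact le_of_tendsto_of_tendsto' h1 h2 fun j =>
    (isTopEigenpair_iff (mixH_isHermitian _ _ _ _) (hk ℓ) (hkn ℓ) (h j ℓ).1).mp (h j ℓ).2 Y hY

/-- The gain in the objective dominates the squared sine distance, weighted with the eigengap. -/
theorem IsSweep.gap_mul_sinTheta_le (hk : ∀ ℓ, 1 ≤ k ℓ) (hkn : ∀ ℓ, k ℓ ≤ n ℓ)
    {P P' : Factors n k} (hP : P ∈ stiefelTuples n k) (h : IsSweep B P P') (ℓ : Fin m) :
    0 ≤ eigGap (mixH B P' P ℓ) (k ℓ) * sinThetaFrob (P' ℓ) (P ℓ) ^ 2 ∧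
    eigGap (mixH B P' P ℓ) (k ℓ) * sinThetaFrob (P' ℓ) (P ℓ) ^ 2 ≤
      objective B P' - objective B P := by
  have hH := mixH_isHermitian B P' P ℓ
  rcases (hkn ℓ).lt_or_eq with hlt | heq
  · refine ⟨mul_nonneg (eigGap_nonneg hH (hk ℓ) hlt) (sq_nonneg _), ?_⟩
    refine le_trans ?_ (h.substep_gain_le hk hkn hP ℓ)
    rw [sinThetaFrob_sq (h ℓ).1 (hP ℓ), objective_stage, objective_stage_succ]
    exact (h ℓ).gap_mul_le hH (hk ℓ) hlt (hP ℓ)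
  -- For `k ℓ = n ℓ` the value of `eigGap` involves the default `eig _ (n ℓ + 1) = 0`; it is
  -- harmless because the sine distance vanishes.
  · rw [sinThetaFrob_sq (h ℓ).1 (hP ℓ), sqNorm_conjTranspose_mul_of_eq heq (h ℓ).1 (hP ℓ), sub_self,
      mul_zero]
    exact ⟨le_rfl, sub_nonneg.mpr (h.objective_le hk hkn hP)⟩

/-- The gain in the objective dominates the relative residual, weighted with the eigengap. -/
theorem IsSweep.gap_mul_residual_le (hk : ∀ ℓ, 1 ≤ k ℓ) (hkn : ∀ ℓ, k ℓ ≤ n ℓ)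
    {P P' : Factors n k} (hP : P ∈ stiefelTuples n k) (h : IsSweep B P P') (ℓ : Fin m) :
    0 ≤ eigGap (mixH B P' P ℓ) (k ℓ) * (frob (mixH B P' P ℓ * P ℓ -
      P ℓ * ((P ℓ)ᴴ * mixH B P' P ℓ * P ℓ)) ^ 2 / frob (mixH B P' P ℓ) ^ 2) ∧
    eigGap (mixH B P' P ℓ) (k ℓ) * (frob (mixH B P' P ℓ * P ℓ -
      P ℓ * ((P ℓ)ᴴ * mixH B P' P ℓ * P ℓ)) ^ 2 / frob (mixH B P' P ℓ) ^ 2) ≤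
      4 * (objective B P' - objective B P) := by
  have hH := mixH_isHermitian B P' P ℓ
  have hsin := sinThetaFrob_sq (h ℓ).1 (hP ℓ)
  have hres := sqNorm_residual_le hH (hP ℓ) (h ℓ).1 (h ℓ).2.1
  rw [← hsin, ← frob_sq, ← frob_sq] at hres
  set e := frob (mixH B P' P ℓ * P ℓ - P ℓ * ((P ℓ)ᴴ * mixH B P' P ℓ * P ℓ)) ^ 2 /
    frob (mixH B P' P ℓ) ^ 2 with he
  have he0 : 0 ≤ e := by positivity
  -- `div_le_of_le_mul₀` also covers a zero matrix `H_ℓ`, where the quotient is `0`.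
  have hle : e ≤ 4 * sinThetaFrob (P' ℓ) (P ℓ) ^ 2 :=
    div_le_of_le_mul₀ (sq_nonneg _) (by positivity) hres
  obtain ⟨h1, h2⟩ := h.gap_mul_sinTheta_le hk hkn hP ℓ
  rcases (hkn ℓ).lt_or_eq with hlt | heq
  · have hg := eigGap_nonneg hH (hk ℓ) hlt
    refine ⟨mul_nonneg hg he0, (mul_le_mul_of_nonneg_left hle hg).trans ?_⟩
    linarith
  · rw [hsin, sqNorm_conjTranspose_mul_of_eq heq (h ℓ).1 (hP ℓ), sub_self, mul_zero] at hle
    rw [le_antisymm hle he0, mul_zero]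
    exact ⟨le_rfl, by linarith⟩

end Sweep

/-! ### The whole iteration and its limits -/

section Iteration

variable {m : ℕ} {n k : Fin m → ℕ} {B : Tensor n} {P : ℕ → Factors n k}

lemma IsHOOI.mem_stiefelTuples (hP : IsHOOI B P) (j : ℕ) : P j ∈ stiefelTuples n k := by
  intro ℓ
  cases j with
  | zero => exact hP.init ℓ
  | succ j => exact (hP.step j ℓ).1

lemma IsHOOI.isSweep (hP : IsHOOI B P) (j : ℕ) : IsSweep B (P j) (P (j + 1)) := hP.step j

lemma IsHOOI.monotone_objective (hk : ∀ ℓ, 1 ≤ k ℓ) (hkn : ∀ ℓ, k ℓ ≤ n ℓ) (hP : IsHOOI B P) :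
    Monotone fun j => objective B (P j) :=
  monotone_nat_of_le_succ fun j => (hP.isSweep j).objective_le hk hkn (hP.mem_stiefelTuples j)

lemma IsHOOI.exists_tendsto_objective (hk : ∀ ℓ, 1 ≤ k ℓ) (hkn : ∀ ℓ, k ℓ ≤ n ℓ)
    (hP : IsHOOI B P) : ∃ c : ℝ, Tendsto (fun j => objective B (P j)) atTop (𝓝 c) := by
  refine ⟨_, tendsto_atTop_ciSup (hP.monotone_objective hk hkn) ?_⟩
  refine ((isCompact_stiefelTuples n k).image (continuous_objective B)).bddAbove.mono ?_
  rintro _ ⟨j, rfl⟩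
  exact ⟨P j, hP.mem_stiefelTuples j, rfl⟩

/-- The gains are nonnegative and telescope, with partial sums bounded by the limit of the objective
minus its initial value. -/
lemma IsHOOI.summable_of_gain_le (hk : ∀ ℓ, 1 ≤ k ℓ) (hkn : ∀ ℓ, k ℓ ≤ n ℓ) (hP : IsHOOI B P)
    {a : ℕ → ℝ} {C : ℝ} (ha : ∀ j, 0 ≤ a j ∧
      a j ≤ C * (objective B (P (j + 1)) - objective B (P j))) : Summable a := by
  obtain ⟨c, hc⟩ := hP.exists_tendsto_objective hk hkn
  have hmono := hP.monotone_objective hk hkn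
  have hs : Summable fun j => objective B (P (j + 1)) - objective B (P j) := by
    refine summable_of_sum_range_le (c := c - objective B (P 0))
      (fun j => sub_nonneg.mpr (hmono j.le_succ)) fun N => ?_
    rw [Finset.sum_range_sub fun j => objective B (P j)]
    exact sub_le_sub_right (hmono.ge_of_tendsto hc N) _
  exact Summable.of_nonneg_of_le (fun j => (ha j).1) (fun j => (ha j).2) (hs.mul_left C)

/-- Passing to the limit in the iteration gives a sweep that does not increase the objective. -/
lemma IsHOOI.limit (hk : ∀ ℓ, 1 ≤ k ℓ) (hkn : ∀ ℓ, k ℓ ≤ n ℓ) (hP : IsHOOI B P) {u : Filter ℕ}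
    [u.NeBot] (hu : u ≤ atTop) {Pstar P' : Factors n k} (h : Tendsto P u (𝓝 Pstar))
    (h' : Tendsto (fun j => P (j + 1)) u (𝓝 P')) :
    Pstar ∈ stiefelTuples n k ∧ IsSweep B Pstar P' ∧ objective B P' = objective B Pstar := by
  refine ⟨(isCompact_stiefelTuples n k).isClosed.mem_of_tendsto h
    (Eventually.of_forall hP.mem_stiefelTuples), IsSweep.of_tendsto hk hkn hP.isSweep h h', ?_⟩
  obtain ⟨c, hc⟩ := hP.exists_tendsto_objective hk hkn
  have h1 : Tendsto (fun j => objective B (P j)) u (𝓝 (objective B Pstar)) :=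
    ((continuous_objective B).tendsto Pstar).comp h
  have h2 : Tendsto (fun j => objective B (P (j + 1))) u (𝓝 (objective B P')) :=
    ((continuous_objective B).tendsto P').comp h'
  rw [tendsto_nhds_unique h2 (((tendsto_add_atTop_iff_nat 1).mpr hc).mono_left hu),
    tendsto_nhds_unique h1 (hc.mono_left hu)]

lemma IsHOOI.exists_tendsto (hP : IsHOOI B P) (u : Ultrafilter ℕ) (a : ℕ → ℕ) :
    ∃ P' : Factors n k, Tendsto (fun j => P (a j)) u (𝓝 P') := by
  obtain ⟨P', -, h⟩ := (isCompact_stiefelTuples n k).ultrafilter_le_nhds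
    (u.map fun j => P (a j)) (le_principal_iff.mpr
      (Eventually.of_forall fun j => hP.mem_stiefelTuples (a j) :
        ∀ᶠ j in (u : Filter ℕ), P (a j) ∈ stiefelTuples n k))
  exact ⟨P', h⟩

/-- Close to an accumulation point with positive eigengaps, a step of the iteration with aligned
bases moves the iterate arbitrarily little. -/
theorem IsHOOI.tendsto_aligned_succ (hk : ∀ ℓ, 1 ≤ k ℓ) (hkn : ∀ ℓ, k ℓ ≤ n ℓ) (hP : IsHOOI B P)
    {Pstar : Factors n k} (hst : Pstar ∈ stiefelTuples n k)
    (hgap : ∀ ℓ, HasPosGap (matH B Pstar ℓ) (k ℓ))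
    {Q : ℕ → ∀ ℓ, Matrix (Fin (k ℓ)) (Fin (k ℓ)) ℂ}
    (hQ : ∀ j ℓ, IsPolarFactor ((P j ℓ)ᴴ * Pstar ℓ) (Q j ℓ)) {u : Ultrafilter ℕ}
    (hu : (u : Filter ℕ) ≤ atTop) (h : Tendsto (fun j ℓ => P j ℓ * Q j ℓ) u (𝓝 Pstar)) :
    Tendsto (fun j ℓ => P (j + 1) ℓ * Q (j + 1) ℓ) u (𝓝 Pstar) := by
  -- Only the aligned iterates are assumed to converge along `u`; compactness supplies limits of the
  -- raw iterates, which may differ from `Pstar` by a rotation.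
  obtain ⟨P₀, hP₀⟩ := hP.exists_tendsto u id
  obtain ⟨P₁, hP₁⟩ := hP.exists_tendsto u (· + 1)
  obtain ⟨hst₀, hsweep, hobj⟩ := hP.limit hk hkn hu hP₀ hP₁
  have hQlim : ∀ (a : ℕ → ℕ) (ℓ : Fin m), ∃ Q' : Matrix (Fin (k ℓ)) (Fin (k ℓ)) ℂ,
      IsStiefel Q' ∧ Tendsto (fun j => Q (a j) ℓ) u (𝓝 Q') := by
    intro a ℓ
    obtain ⟨Q', h1, h2⟩ := (isCompact_isStiefel (k ℓ) (k ℓ)).ultrafilter_le_nhds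
      (u.map fun j => Q (a j) ℓ) (le_principal_iff.mpr
        (Eventually.of_forall fun j => (hQ (a j) ℓ).1 :
          ∀ᶠ j in (u : Filter ℕ), IsStiefel (Q (a j) ℓ)))
    exact ⟨Q', h1, h2⟩
  have hproj₀ : ∀ ℓ, Pstar ℓ * (Pstar ℓ)ᴴ = P₀ ℓ * (P₀ ℓ)ᴴ := by
    intro ℓ
    obtain ⟨Q₀, hQ₀, hQ₀lim⟩ := hQlim id ℓ
    have h1 : Tendsto (fun j => P j ℓ * Q j ℓ) u (𝓝 (P₀ ℓ * Q₀)) :=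
      tendsto_matrix_mul (tendsto_pi_nhds.mp hP₀ ℓ) hQ₀lim
    rw [tendsto_nhds_unique (tendsto_pi_nhds.mp h ℓ) h1]
    exact hQ₀.mul_mul_conjTranspose
  have hgap₀ : ∀ ℓ, HasPosGap (matH B P₀ ℓ) (k ℓ) := by
    intro ℓ
    rw [← matH_congr B fun r _ => hproj₀ r]
    exact hgap ℓ
  refine tendsto_pi_nhds.mpr fun ℓ => ?_
  obtain ⟨hU, hPU⟩ := hsweep.eq_mul hk hkn hst₀ hobj ℓ fun r _ => hgap₀ r
  have hproj : P₁ ℓ * (P₁ ℓ)ᴴ = Pstar ℓ * (Pstar ℓ)ᴴ := by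
    rw [hproj₀ ℓ, hPU]
    exact hU.mul_mul_conjTranspose
  obtain ⟨Q₁, hQ₁, hQ₁lim⟩ := hQlim (· + 1) ℓ
  have hP₁ℓ := tendsto_pi_nhds.mp hP₁ ℓ
  have hlim : Tendsto (fun j => P (j + 1) ℓ * Q (j + 1) ℓ) u (𝓝 (P₁ ℓ * Q₁)) :=
    tendsto_matrix_mul hP₁ℓ hQ₁lim
  have hΓlim : Tendsto (fun j => (Q (j + 1) ℓ)ᴴ * ((P (j + 1) ℓ)ᴴ * Pstar ℓ)) u
      (𝓝 (Q₁ᴴ * ((P₁ ℓ)ᴴ * Pstar ℓ))) :=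
    tendsto_matrix_mul (tendsto_conjTranspose hQ₁lim)
      (tendsto_matrix_mul (tendsto_conjTranspose hP₁ℓ) tendsto_const_nhds)
  -- The limit `Q₁` is again a polar factor. As `P₁ ℓ` and `Pstar ℓ` span the same space, `(P₁ ℓ)ᴴ *
  -- Pstar ℓ` is unitary, so its semidefinite part is `1` and `Q₁` undoes the rotation exactly.
  have hΓ : (Q₁ᴴ * ((P₁ ℓ)ᴴ * Pstar ℓ)).PosSemidef := by
    refine isClosed_posSemidef.mem_of_tendsto hΓlim (Eventually.of_forall fun j => ?_)
    obtain ⟨hQj, Γ, hΓ, hA⟩ := hQ (j + 1) ℓ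
    have : (Q (j + 1) ℓ)ᴴ * ((P (j + 1) ℓ)ᴴ * Pstar ℓ) = Γ := by
      rw [hA, ← Matrix.mul_assoc, hQj, Matrix.one_mul]
    rwa [Set.mem_ofPred_eq, this]
  have hback : P₁ ℓ * ((P₁ ℓ)ᴴ * Pstar ℓ) = Pstar ℓ := by
    rw [← Matrix.mul_assoc, hproj, Matrix.mul_assoc, hst ℓ, Matrix.mul_one]
  have hcancel : Q₁ * (Q₁ᴴ * ((P₁ ℓ)ᴴ * Pstar ℓ)) = (P₁ ℓ)ᴴ * Pstar ℓ := by
    rw [← Matrix.mul_assoc, hQ₁.mul_conjTranspose, Matrix.one_mul]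
  have hone : Q₁ᴴ * ((P₁ ℓ)ᴴ * Pstar ℓ) = 1 := by
    have hsq : (Q₁ᴴ * ((P₁ ℓ)ᴴ * Pstar ℓ))ᴴ * (Q₁ᴴ * ((P₁ ℓ)ᴴ * Pstar ℓ)) = 1 := by
      rw [Matrix.conjTranspose_mul, Matrix.conjTranspose_conjTranspose, Matrix.mul_assoc, hcancel,
        Matrix.conjTranspose_mul, Matrix.conjTranspose_conjTranspose, Matrix.mul_assoc, hback,
        hst ℓ]
    rw [hΓ.isHermitian.eq] at hsq
    exact eq_one_of_posSemidef_of_sq hΓ hsq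
  rw [hone, Matrix.mul_one] at hcancel
  rwa [hcancel, hback] at hlim

/-- The data of an accumulation point and of an accumulation point of the shifted subsequence,
realized along one ultrafilter. -/
lemma IsHOOI.exists_limit (hk : ∀ ℓ, 1 ≤ k ℓ) (hkn : ∀ ℓ, k ℓ ≤ n ℓ) (hP : IsHOOI B P)
    {Pstar Phat : Factors n k} {φ : ℕ → ℕ} (hφ : StrictMono φ)
    (h : Tendsto (fun i => P (φ i)) atTop (𝓝 Pstar))
    (hhat : MapClusterPt (initial Phat) atTop fun i => initial (P (φ i + 1))) :
    ∃ P' : Factors n k, (∀ ℓ : Fin m, ℓ.val + 1 < m → P' ℓ = Phat ℓ) ∧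
      Pstar ∈ stiefelTuples n k ∧ IsSweep B Pstar P' ∧ objective B P' = objective B Pstar := by
  obtain ⟨u, hu, hulim⟩ := mapClusterPt_iff_ultrafilter.mp hhat
  -- Compactness completes the limit by a last factor, so that `P'` is the end of a full limit
  -- sweep.
  obtain ⟨P', hP'⟩ := hP.exists_tendsto u fun i => φ i + 1
  refine ⟨P', fun ℓ hℓ => ?_, hP.limit hk hkn (u := (u : Filter ℕ).map φ)
    ((map_mono hu).trans hφ.tendsto_atTop) (tendsto_map'_iff.mpr (h.mono_left hu))
    (tendsto_map'_iff.mpr hP')⟩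
  exact tendsto_nhds_unique (tendsto_pi_nhds.mp hP' ℓ) (tendsto_pi_nhds.mp hulim ⟨ℓ, hℓ⟩)

end Iteration

end HOOI

theorem mainTheorem1 {m : ℕ} {n k : Fin m → ℕ} (hk : ∀ ℓ, 1 ≤ k ℓ) (hkn : ∀ ℓ, k ℓ ≤ n ℓ)
    (B : HOOI.Tensor n) (P : ℕ → HOOI.Factors n k) (hP : HOOI.IsHOOI B P) :
    -- (a)
    (Monotone (fun j => HOOI.objective B (P j)) ∧
      ∃ c : ℝ, Tendsto (fun j => HOOI.objective B (P j)) atTop (𝓝 c)) ∧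
    -- `Pstar` is an accumulation point, reached along the subsequence `φ`
    (∀ (Pstar : HOOI.Factors n k) (φ : ℕ → ℕ), StrictMono φ →
      Tendsto (fun i => P (φ i)) atTop (𝓝 Pstar) →
      -- the components of `Phat` before the last one are an accumulation point of the shifted
      -- subsequence; the last component of `Phat` is not used anywhere
      (∀ Phat : HOOI.Factors n k,
        MapClusterPt (HOOI.initial Phat) atTop (fun i => HOOI.initial (P (φ i + 1))) →
        -- (b)
        (∀ ℓ, HOOI.IsTopEigenpair (HOOI.mixH B Phat Pstar ℓ) (Pstar ℓ)) ∧
        -- (c)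
        ((∀ ℓ : Fin m, ℓ.val + 1 < m → HOOI.HasPosGap (HOOI.matH B Pstar ℓ) (k ℓ)) →
          (∀ ℓ : Fin m, ℓ.val + 1 < m →
            ∃ Q : Matrix (Fin (k ℓ)) (Fin (k ℓ)) ℂ, HOOI.IsStiefel Q ∧ Phat ℓ = Pstar ℓ * Q) ∧
          (∀ ℓ, HOOI.mixH B Phat Pstar ℓ = HOOI.matH B Pstar ℓ) ∧
          ∀ ℓ, HOOI.IsTopEigenpair (HOOI.matH B Pstar ℓ) (Pstar ℓ))) ∧
      -- (d)
      (∀ Q : ℕ → ∀ ℓ, Matrix (Fin (k ℓ)) (Fin (k ℓ)) ℂ,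
        (∀ j ℓ, HOOI.IsPolarFactor ((P j ℓ)ᴴ * Pstar ℓ) (Q j ℓ)) →
        HOOI.IsIsolatedAccPt (fun j ℓ => P j ℓ * Q j ℓ) Pstar →
        (∀ ℓ, HOOI.HasPosGap (HOOI.matH B Pstar ℓ) (k ℓ)) →
        Tendsto (fun j ℓ => P j ℓ * Q j ℓ) atTop (𝓝 Pstar))) ∧
    -- (e)
    (∀ ℓ,
      Summable (fun j => HOOI.eigGap (HOOI.mixH B (P (j + 1)) (P j) ℓ) (k ℓ) *
        HOOI.sinThetaFrob (P (j + 1) ℓ) (P j ℓ) ^ 2) ∧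
      Summable (fun j => HOOI.eigGap (HOOI.mixH B (P (j + 1)) (P j) ℓ) (k ℓ) *
        (HOOI.frob (HOOI.mixH B (P (j + 1)) (P j) ℓ * P j ℓ -
            P j ℓ * ((P j ℓ)ᴴ * HOOI.mixH B (P (j + 1)) (P j) ℓ * P j ℓ)) ^ 2 /
          HOOI.frob (HOOI.mixH B (P (j + 1)) (P j) ℓ) ^ 2))) := by
  refine ⟨⟨hP.monotone_objective hk hkn, hP.exists_tendsto_objective hk hkn⟩, ?_, fun ℓ => ⟨?_, ?_⟩⟩
  · intro Pstar φ hφ hPstar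
    refine ⟨fun Phat hhat => ?_, fun Q hQ hiso hgap => ?_⟩
    · obtain ⟨P', heq, hst, hsweep, hobj⟩ := hP.exists_limit hk hkn hφ hPstar hhat
      have hlt : ∀ {ℓ r : Fin m}, r < ℓ → r.val + 1 < m := fun {ℓ r} hr => by
        have := Fin.lt_def.mp hr
        omega
      -- Only components `r < ℓ` of the new tuple enter, and on those `Phat` and `P'` agree.
      have hmix : ∀ ℓ, HOOI.mixH B Phat Pstar ℓ = HOOI.mixH B P' Pstar ℓ := by
        intro ℓ
        have : HOOI.mix Phat Pstar ℓ = HOOI.mix P' Pstar ℓ := by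
          funext r
          unfold HOOI.mix
          split_ifs with hr
          · exact (heq r (hlt hr)).symm
          · rfl
        rw [HOOI.mixH, HOOI.mixH, this]
      have hb : ∀ ℓ, HOOI.IsTopEigenpair (HOOI.mixH B Phat Pstar ℓ) (Pstar ℓ) := fun ℓ => by
        rw [hmix ℓ]
        exact hsweep.isTopEigenpair hk hkn hst hobj ℓ
      refine ⟨hb, fun hgap => ?_⟩
      have hQ : ∀ ℓ : Fin m, ℓ.val + 1 < m →
          HOOI.IsStiefel ((Pstar ℓ)ᴴ * P' ℓ) ∧ P' ℓ = Pstar ℓ * ((Pstar ℓ)ᴴ * P' ℓ) :=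
        fun ℓ hℓ => hsweep.eq_mul hk hkn hst hobj ℓ fun r hr => hgap r (by
          have := Fin.le_def.mp hr
          omega)
      have hH : ∀ ℓ, HOOI.mixH B Phat Pstar ℓ = HOOI.matH B Pstar ℓ := fun ℓ => by
        rw [hmix ℓ]
        refine HOOI.mixH_eq_matH fun r hr => ?_
        obtain ⟨h1, h2⟩ := hQ r (hlt hr)
        conv_lhs => rw [h2]
        exact h1.mul_mul_conjTranspose
      refine ⟨fun ℓ hℓ => ⟨_, (hQ ℓ hℓ).1, ?_⟩, hH, fun ℓ => hH ℓ ▸ hb ℓ⟩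
      rw [← heq ℓ hℓ]
      exact (hQ ℓ hℓ).2
    · have hst : Pstar ∈ HOOI.stiefelTuples n k :=
        (HOOI.isCompact_stiefelTuples n k).isClosed.mem_of_tendsto hPstar
          (Eventually.of_forall fun i => hP.mem_stiefelTuples (φ i))
      have : ∀ a b, RegularSpace (Matrix (Fin a) (Fin b) ℂ) := fun a b =>
        inferInstanceAs (RegularSpace (Fin a → Fin b → ℂ))
      exact HOOI.tendsto_of_isIsolatedAccPt (HOOI.isCompact_stiefelTuples n k)
        (fun j ℓ => (hP.mem_stiefelTuples j ℓ).mul (hQ j ℓ).1) hiso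
        fun u hu h => hP.tendsto_aligned_succ hk hkn hst hgap hQ hu h
  · exact hP.summable_of_gain_le hk hkn (C := 1) fun j => by
      rw [one_mul]
      exact (hP.isSweep j).gap_mul_sinTheta_le hk hkn (hP.mem_stiefelTuples j) ℓ
  · exact hP.summable_of_gain_le hk hkn (C := 4) fun j =>
      (hP.isSweep j).gap_mul_residual_le hk hkn (hP.mem_stiefelTuples j) ℓ
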